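/- Let $\mathscr{G}\rightrightarrows M$ be a Lie groupoid with source $s$, target $t$ and unit map $\mathrm{Id}$ (all manifolds are smooth and finite-dimensional, and $M$ is Hausdorff), such that either $M$ is a single point (or empty), or $\dim\mathscr{G}>\dim M$. Let $\mathbb{B}$ be its group of bisections, i.e. of smooth maps $\beta\colon M\to\mathscr{G}$ with $s\circ\beta=\mathrm{id}_M$ and $t_*\beta:=t\circ\beta\in\mathrm{Diff}(M)$, with product $(\beta\cdot\gamma)(m)=\beta(t(\gamma(m))).\gamma(m)$. It acts on $\mathscr{G}$ from the left by $L_\beta(g)=\beta(t(g)).g$ and from the right by $R_\beta(g)=g.(\beta^{-1}(s(g)))^{-1}=g.\beta((t_*\beta)^{-1}(s(g)))$. Assume that $\mathscr{G}$ is $\mathrm{Id}$-reducible: for every $g\in\mathscr{G}$ there is $\beta\in\mathbb{B}$ with $\beta(s(g))=g$. (1) The centraliser of $R(\mathbb{B})$ in $\mathrm{Diff}(\mathscr{G})$ is $L(\mathbb{B})$. (2) Let $\pi\colon P\to\Sigma$ be a map of manifolds; a local trivialisation means a diffeomorphism $\tau\colon\pi^{-1}(O)\to O\times\mathscr{G}$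 over an open set $O\subset\Sigma$. Consider the following three kinds of structure on $\pi$. (a) A principaloid bundle structure: an equivalence class of atlases of local trivialisations over open sets covering $\Sigma$ whose transition maps have the form $(\sigma,g)\mapsto(\sigma,L_{\beta(\sigma)}(g))$ with $\beta(\sigma)\in\mathbb{B}$ and $(\sigma,m)\mapsto\beta(\sigma)(m)$ smooth; two atlases are equivalent if their union is again such an atlas. (b) A principaloid $\mathscr{G}$-bundle structure: a right $\mathscr{G}$-module structure on $P$, i.e. a smooth moment map $\mu\colon P\to M$ and a smooth action $(p,g)\mapsto p\blacktriangleleft g$ on $\{\mu(p)=t(g)\}$ with $\mu(p\blacktriangleleft g)=s(g)$, $p\blacktriangleleft\mathrm{Id}_{\mu(p)}=p$, $(p\blacktriangleleft g)\blacktriangleleft h=p\blacktriangleleft(g.h)$, which preserves the fibres of $\pi$ and for which every point of $\Sigma$ lies in the base of an equivariant local trivialisation ($\mathscr{G}$ acting on the fibre $\mathscr{G}$ by right translations). (c) A $\mathscr{G}$-fibred $\mathbb{B}$-bundle structure: a right action of $\mathbb{B}$ on $P$ by diffeomorphisms which preserve the fibres of $\pi$, for which every point of $\Sigma$ lies in the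 base of an equivariant local trivialisation ($\mathbb{B}$ acting on the fibre $\mathscr{G}$ by $R$). Then there is a bijection from structures (a) to structures (c), under which the class of an atlas corresponds to an action if and only if all trivialisations of the atlas are equivariant for that action. Any two $\mathbb{B}$-equivariant local trivialisations of a $\mathscr{G}$-fibred $\mathbb{B}$-bundle have a transition map of the form required in (a). There is also a bijection from structures (b) to structures (c), given by $p\vartriangleleft\beta=p\blacktriangleleft\beta((t_*\beta)^{-1}(\mu(p)))$, and corresponding structures have the same equivariant local trivialisations. -/

import Mathlib

open scoped Manifold ContDiff

/-! Throughout, manifolds are modelled on (finite-dimensional) real vector spaces `E` through the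
model `𝓘(ℝ, E)`, and "smooth" means `C^∞`. -/

section DiffeomorphismGroup

variable {E : Type*} [NormedAddCommGroup E] [NormedSpace ℝ E]
  {X : Type*} [TopologicalSpace X] [ChartedSpace E X]

/-- The group `Diff(X)` of diffeomorphisms of a manifold, with `(φ * ψ) x = φ (ψ x)`. -/
noncomputable instance diffGroup : Group (Diffeomorph 𝓘(ℝ, E) 𝓘(ℝ, E) X X ∞) where
  mul φ ψ := ψ.trans φ
  one := Diffeomorph.refl 𝓘(ℝ, E) X ∞
  inv φ := φ.symm
  mul_assoc _ _ _ := rfl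
  one_mul _ := rfl
  mul_one _ := rfl
  inv_mul_cancel φ := Diffeomorph.ext fun x => φ.symm_apply_apply x

theorem diff_mul_apply (φ ψ : Diffeomorph 𝓘(ℝ, E) 𝓘(ℝ, E) X X ∞) (x : X) :
    (φ * ψ) x = φ (ψ x) := rfl

theorem diff_one_apply (x : X) : (1 : Diffeomorph 𝓘(ℝ, E) 𝓘(ℝ, E) X X ∞) x = x := rfl

end DiffeomorphismGroup

/-- A Lie groupoid with object manifold `M` (modelled on `EM`) and arrow manifold `G`
(modelled on `EG`). An arrow `g` goes from `s g` to `t g`, and the product `mul g h` (written `g.h`)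
is meaningful only for composable pairs, those with `s g = t h`; its values on other pairs are
irrelevant. Surjectivity of the submersions `s` and `t` is a consequence of `s_unit` and
`t_unit`. The set of composable pairs is an embedded submanifold of `G × G`, so smoothness of the
product on it is `ContMDiffOn`. -/
structure LieGroupoid (EM EG M G : Type*)
    [NormedAddCommGroup EM] [NormedSpace ℝ EM] [NormedAddCommGroup EG] [NormedSpace ℝ EG]
    [TopologicalSpace M] [ChartedSpace EM M] [TopologicalSpace G] [ChartedSpace EG G] where
  /-- source -/
  s : G → M
  /-- target -/
  t : G → M
  /-- unit arrow -/
  unit : M → G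
  /-- inverse arrow -/
  inv : G → G
  /-- multiplication of composable arrows -/
  mul : G → G → G
  s_unit : ∀ m, s (unit m) = m
  t_unit : ∀ m, t (unit m) = m
  s_mul : ∀ g h, s g = t h → s (mul g h) = s h
  t_mul : ∀ g h, s g = t h → t (mul g h) = t g
  mul_assoc : ∀ g h k, s g = t h → s h = t k → mul (mul g h) k = mul g (mul h k)
  unit_mul : ∀ g, mul (unit (t g)) g = g
  mul_unit : ∀ g, mul g (unit (s g)) = g
  s_inv : ∀ g, s (inv g) = t g
  t_inv : ∀ g, t (inv g) = s g
  mul_inv : ∀ g, mul g (inv g) = unit (t g)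
  inv_mul : ∀ g, mul (inv g) g = unit (s g)
  contMDiff_s : ContMDiff 𝓘(ℝ, EG) 𝓘(ℝ, EM) ∞ s
  contMDiff_t : ContMDiff 𝓘(ℝ, EG) 𝓘(ℝ, EM) ∞ t
  contMDiff_unit : ContMDiff 𝓘(ℝ, EM) 𝓘(ℝ, EG) ∞ unit
  contMDiff_inv : ContMDiff 𝓘(ℝ, EG) 𝓘(ℝ, EG) ∞ inv
  contMDiffOn_mul : ContMDiffOn (𝓘(ℝ, EG).prod 𝓘(ℝ, EG)) 𝓘(ℝ, EG) ∞
    (fun x : G × G => mul x.1 x.2) {x | s x.1 = t x.2}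
  isSubmersion_s : Manifold.IsSubmersion 𝓘(ℝ, EG) 𝓘(ℝ, EM) ∞ s
  isSubmersion_t : Manifold.IsSubmersion 𝓘(ℝ, EG) 𝓘(ℝ, EM) ∞ t

namespace LieGroupoid

variable {EM EG M G : Type*}
  [NormedAddCommGroup EM] [NormedSpace ℝ EM] [NormedAddCommGroup EG] [NormedSpace ℝ EG]
  [TopologicalSpace M] [ChartedSpace EM M] [TopologicalSpace G] [ChartedSpace EG G]

section Bisections

variable (Γ : LieGroupoid EM EG M G)

/-- A (global) bisection: a smooth section `β` of the source map such that `t ∘ β` is a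
diffeomorphism of `M`. That diffeomorphism, the shadow of `β`, is determined by `β`; it is recorded
together with its inverse. -/
structure Bisection where
  /-- the underlying section of the source map -/
  toFun : M → G
  contMDiff_toFun : ContMDiff 𝓘(ℝ, EM) 𝓘(ℝ, EG) ∞ toFun
  s_toFun : ∀ m, Γ.s (toFun m) = m
  /-- the diffeomorphism `t ∘ β` of `M` -/
  shadow : Diffeomorph 𝓘(ℝ, EM) 𝓘(ℝ, EM) M M ∞
  shadow_apply : ∀ m, shadow m = Γ.t (toFun m)

/-- Through every arrow there is a global bisection. -/
def IsIdReducible : Prop :=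
  ∀ g : G, ∃ β : Γ.Bisection, β.toFun (Γ.s g) = g

variable {Γ}

theorem contMDiff_mul_comp {E' X : Type*} [NormedAddCommGroup E'] [NormedSpace ℝ E']
    [TopologicalSpace X] [ChartedSpace E' X] {f h : X → G}
    (hf : ContMDiff 𝓘(ℝ, E') 𝓘(ℝ, EG) ∞ f) (hh : ContMDiff 𝓘(ℝ, E') 𝓘(ℝ, EG) ∞ h)
    (hfh : ∀ x, Γ.s (f x) = Γ.t (h x)) :
    ContMDiff 𝓘(ℝ, E') 𝓘(ℝ, EG) ∞ (fun x => Γ.mul (f x) (h x)) :=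
  Γ.contMDiffOn_mul.comp_contMDiff (hf.prodMk hh) hfh

theorem inv_inv (g : G) : Γ.inv (Γ.inv g) = g := by
  have h1 : Γ.mul (Γ.mul (Γ.inv (Γ.inv g)) (Γ.inv g)) g
      = Γ.mul (Γ.inv (Γ.inv g)) (Γ.mul (Γ.inv g) g) :=
    Γ.mul_assoc _ _ _ (Γ.s_inv _) (Γ.s_inv _)
  rw [Γ.inv_mul, Γ.inv_mul, Γ.s_inv, Γ.unit_mul] at h1
  have h2 : Γ.s g = Γ.s (Γ.inv (Γ.inv g)) := by rw [Γ.s_inv, Γ.t_inv]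
  rw [h2, Γ.mul_unit] at h1
  exact h1.symm

namespace Bisection

theorem ext' {β γ : Γ.Bisection} (h : ∀ m, β.toFun m = γ.toFun m) : β = γ := by
  have hs : β.shadow = γ.shadow := Diffeomorph.ext fun m => by
    rw [β.shadow_apply, γ.shadow_apply, h]
  cases β; cases γ
  obtain rfl := funext h
  obtain rfl := hs
  rfl

theorem t_toFun_symm (β : Γ.Bisection) (m : M) : Γ.t (β.toFun (β.shadow.symm m)) = m := by
  rw [← β.shadow_apply, Diffeomorph.apply_symm_apply]

/-- The product of bisections, `(β · γ)(m) = β(t(γ(m))).γ(m)`. -/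
noncomputable def mulB (β γ : Γ.Bisection) : Γ.Bisection where
  toFun m := Γ.mul (β.toFun (γ.shadow m)) (γ.toFun m)
  contMDiff_toFun := contMDiff_mul_comp (β.contMDiff_toFun.comp γ.shadow.contMDiff)
    γ.contMDiff_toFun fun m => by rw [β.s_toFun, γ.shadow_apply]
  s_toFun m := by
    rw [Γ.s_mul _ _ (by rw [β.s_toFun, γ.shadow_apply]), γ.s_toFun]
  shadow := γ.shadow.trans β.shadow
  shadow_apply m := by
    rw [Γ.t_mul _ _ (by rw [β.s_toFun, γ.shadow_apply]), ← β.shadow_apply]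
    rfl

/-- The unit bisection. -/
noncomputable def oneB : Γ.Bisection where
  toFun := Γ.unit
  contMDiff_toFun := Γ.contMDiff_unit
  s_toFun := Γ.s_unit
  shadow := Diffeomorph.refl 𝓘(ℝ, EM) M ∞
  shadow_apply m := (Γ.t_unit m).symm

/-- The inverse bisection, `β⁻¹ = Inv ∘ β ∘ (t ∘ β)⁻¹`. -/
noncomputable def invB (β : Γ.Bisection) : Γ.Bisection where
  toFun m := Γ.inv (β.toFun (β.shadow.symm m))
  contMDiff_toFun := Γ.contMDiff_inv.comp (β.contMDiff_toFun.comp β.shadow.symm.contMDiff)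
  s_toFun m := by rw [Γ.s_inv, β.t_toFun_symm]
  shadow := β.shadow.symm
  shadow_apply m := by rw [Γ.t_inv, β.s_toFun]

/-- The group of bisections. -/
noncomputable instance instGroup : Group Γ.Bisection where
  mul := mulB
  one := oneB
  inv := invB
  mul_assoc α β γ := ext' fun m => by
    change Γ.mul (Γ.mul (α.toFun (β.shadow (γ.shadow m))) (β.toFun (γ.shadow m))) (γ.toFun m)
      = Γ.mul (α.toFun (β.shadow (γ.shadow m))) (Γ.mul (β.toFun (γ.shadow m)) (γ.toFun m))
    exact Γ.mul_assoc _ _ _ (by rw [α.s_toFun, β.shadow_apply]) (by rw [β.s_toFun, γ.shadow_apply])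
  one_mul β := ext' fun m => by
    change Γ.mul (Γ.unit (β.shadow m)) (β.toFun m) = β.toFun m
    rw [β.shadow_apply, Γ.unit_mul]
  mul_one β := ext' fun m => by
    change Γ.mul (β.toFun m) (Γ.unit m) = β.toFun m
    conv_lhs => rw [← β.s_toFun m]
    rw [β.s_toFun m, show Γ.unit m = Γ.unit (Γ.s (β.toFun m)) by rw [β.s_toFun], Γ.mul_unit]
  inv_mul_cancel β := ext' fun m => by
    change Γ.mul (Γ.inv (β.toFun (β.shadow.symm (β.shadow m)))) (β.toFun m) = Γ.unit m
    rw [Diffeomorph.symm_apply_apply, Γ.inv_mul, β.s_toFun]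

theorem mul_toFun (β γ : Γ.Bisection) (m : M) :
    (β * γ).toFun m = Γ.mul (β.toFun (γ.shadow m)) (γ.toFun m) := rfl

theorem mul_shadow (β γ : Γ.Bisection) (m : M) :
    (β * γ).shadow m = β.shadow (γ.shadow m) := rfl

theorem one_toFun (m : M) : (1 : Γ.Bisection).toFun m = Γ.unit m := rfl

theorem inv_toFun (β : Γ.Bisection) (m : M) :
    (β⁻¹).toFun m = Γ.inv (β.toFun (β.shadow.symm m)) := rfl

/-- Left-multiplication `L_β(g) = β(t(g)).g`. -/
noncomputable def lmul (β : Γ.Bisection) (g : G) : G := Γ.mul (β.toFun (Γ.t g)) g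

/-- Right-multiplication `R_β(g) = g.(β⁻¹(s(g)))⁻¹`. -/
noncomputable def rmul (β : Γ.Bisection) (g : G) : G := Γ.mul g (Γ.inv ((β⁻¹).toFun (Γ.s g)))

theorem rmul_eq (β : Γ.Bisection) (g : G) :
    β.rmul g = Γ.mul g (β.toFun (β.shadow.symm (Γ.s g))) := by
  rw [rmul, inv_toFun, inv_inv]

theorem s_rmul (β : Γ.Bisection) (g : G) : Γ.s (β.rmul g) = β.shadow.symm (Γ.s g) := by
  rw [rmul_eq, Γ.s_mul _ _ (β.t_toFun_symm _).symm, β.s_toFun]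

theorem t_lmul (β : Γ.Bisection) (g : G) : Γ.t (β.lmul g) = β.shadow (Γ.t g) := by
  rw [lmul, Γ.t_mul _ _ (β.s_toFun _), β.shadow_apply]

theorem lmul_mul (β γ : Γ.Bisection) (g : G) : (β * γ).lmul g = β.lmul (γ.lmul g) := by
  have h : β.lmul (γ.lmul g) = Γ.mul (β.toFun (Γ.t (γ.lmul g))) (γ.lmul g) := rfl
  rw [h, t_lmul, lmul, mul_toFun, lmul]
  exact Γ.mul_assoc _ _ _ (by rw [β.s_toFun, γ.shadow_apply]) (γ.s_toFun _)

theorem rmul_mul (β γ : Γ.Bisection) (g : G) : (β * γ).rmul g = γ.rmul (β.rmul g) := by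
  rw [rmul_eq γ, s_rmul, rmul_eq, rmul_eq β]
  change Γ.mul g (Γ.mul (β.toFun (γ.shadow (γ.shadow.symm (β.shadow.symm (Γ.s g)))))
    (γ.toFun (γ.shadow.symm (β.shadow.symm (Γ.s g))))) = _
  rw [Diffeomorph.apply_symm_apply]
  exact (Γ.mul_assoc _ _ _ (β.t_toFun_symm _).symm
    (by rw [β.s_toFun, γ.t_toFun_symm])).symm

theorem lmul_one (g : G) : (1 : Γ.Bisection).lmul g = g := Γ.unit_mul g

theorem rmul_one (g : G) : (1 : Γ.Bisection).rmul g = g := by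
  rw [rmul_eq]
  exact Γ.mul_unit g

theorem contMDiff_lmul (β : Γ.Bisection) : ContMDiff 𝓘(ℝ, EG) 𝓘(ℝ, EG) ∞ β.lmul :=
  contMDiff_mul_comp (β.contMDiff_toFun.comp Γ.contMDiff_t) contMDiff_id fun _ => β.s_toFun _

theorem contMDiff_rmul (β : Γ.Bisection) : ContMDiff 𝓘(ℝ, EG) 𝓘(ℝ, EG) ∞ β.rmul :=
  contMDiff_mul_comp contMDiff_id
    (Γ.contMDiff_inv.comp ((β⁻¹).contMDiff_toFun.comp Γ.contMDiff_s)) fun g => by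
      rw [Γ.t_inv, (β⁻¹).s_toFun]

end Bisection

variable (Γ)

/-- The homomorphism `L : 𝔹 → Diff(G)`; its range is the group `L(𝔹)`. -/
noncomputable def leftMul : Γ.Bisection →* Diffeomorph 𝓘(ℝ, EG) 𝓘(ℝ, EG) G G ∞ where
  toFun β :=
    { toFun := β.lmul
      invFun := (β⁻¹).lmul
      left_inv := fun g => by rw [← Bisection.lmul_mul, inv_mul_cancel, Bisection.lmul_one]
      right_inv := fun g => by rw [← Bisection.lmul_mul, mul_inv_cancel, Bisection.lmul_one]
      contMDiff_toFun := β.contMDiff_lmul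
      contMDiff_invFun := (β⁻¹).contMDiff_lmul }
  map_one' := Diffeomorph.ext fun g => Bisection.lmul_one g
  map_mul' β γ := Diffeomorph.ext fun g => Bisection.lmul_mul β γ g

/-- The right action `R` of `𝔹` on `G` as a homomorphism from the opposite group; its range is the
group `R(𝔹)`. -/
noncomputable def rightMul : Γ.Bisectionᵐᵒᵖ →* Diffeomorph 𝓘(ℝ, EG) 𝓘(ℝ, EG) G G ∞ where
  toFun β :=
    { toFun := β.unop.rmul
      invFun := (β.unop⁻¹).rmul
      left_inv := fun g => by rw [← Bisection.rmul_mul, mul_inv_cancel, Bisection.rmul_one]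
      right_inv := fun g => by rw [← Bisection.rmul_mul, inv_mul_cancel, Bisection.rmul_one]
      contMDiff_toFun := β.unop.contMDiff_rmul
      contMDiff_invFun := (β.unop⁻¹).contMDiff_rmul }
  map_one' := Diffeomorph.ext fun g => Bisection.rmul_one g
  map_mul' β γ := Diffeomorph.ext fun g => Bisection.rmul_mul γ.unop β.unop g

end Bisections

end LieGroupoid

section Bundles

variable {EM EG EB EP M G B P : Type*}
  [NormedAddCommGroup EM] [NormedSpace ℝ EM] [NormedAddCommGroup EG] [NormedSpace ℝ EG]
  [NormedAddCommGroup EB] [NormedSpace ℝ EB] [NormedAddCommGroup EP] [NormedSpace ℝ EP]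
  [TopologicalSpace M] [ChartedSpace EM M] [TopologicalSpace G] [ChartedSpace EG G]
  [TopologicalSpace B] [ChartedSpace EB B] [TopologicalSpace P] [ChartedSpace EP P]

/-- A smooth local trivialisation of `π : P → B` with fibre `G` over an open set `O = baseSet`:
a diffeomorphism `π⁻¹(O) ≅ O × G` over `O`. -/
structure SmoothTriv (EG EB EP : Type*)
    [NormedAddCommGroup EG] [NormedSpace ℝ EG]
    [NormedAddCommGroup EB] [NormedSpace ℝ EB] [NormedAddCommGroup EP] [NormedSpace ℝ EP]
    (G : Type*) {B P : Type*}
    [TopologicalSpace G] [ChartedSpace EG G]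
    [TopologicalSpace B] [ChartedSpace EB B] [TopologicalSpace P] [ChartedSpace EP P]
    (π : P → B) extends Bundle.Trivialization G π where
  contMDiffOn_toFun : ContMDiffOn 𝓘(ℝ, EP) (𝓘(ℝ, EB).prod 𝓘(ℝ, EG)) ∞
    toOpenPartialHomeomorph toOpenPartialHomeomorph.source
  contMDiffOn_symm : ContMDiffOn (𝓘(ℝ, EB).prod 𝓘(ℝ, EG)) 𝓘(ℝ, EP) ∞
    toOpenPartialHomeomorph.symm toOpenPartialHomeomorph.target

namespace SmoothTriv

variable {π : P → B}

/-- The point `τ⁻¹(σ, g)` of `P`, meaningful for `σ ∈ baseSet`. -/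
def point (τ : SmoothTriv EG EB EP G π) (σ : B) (g : G) : P :=
  τ.toOpenPartialHomeomorph.symm (σ, g)

theorem point_mem_source (τ : SmoothTriv EG EB EP G π) {σ : B} (hσ : σ ∈ τ.baseSet) (g : G) :
    τ.point σ g ∈ τ.source :=
  τ.toOpenPartialHomeomorph.map_target (by rw [τ.target_eq]; exact ⟨hσ, Set.mem_univ g⟩)

theorem proj_point (τ : SmoothTriv EG EB EP G π) {σ : B} (hσ : σ ∈ τ.baseSet) (g : G) :
    π (τ.point σ g) = σ := by
  rw [← τ.proj_toFun _ (τ.point_mem_source hσ g), point,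
    τ.toOpenPartialHomeomorph.right_inv (by rw [τ.target_eq]; exact ⟨hσ, Set.mem_univ g⟩)]

theorem apply_point (τ : SmoothTriv EG EB EP G π) {σ : B} (hσ : σ ∈ τ.baseSet) (g : G) :
    τ.toOpenPartialHomeomorph (τ.point σ g) = (σ, g) :=
  τ.toOpenPartialHomeomorph.right_inv (by rw [τ.target_eq]; exact ⟨hσ, Set.mem_univ g⟩)

theorem point_apply (τ : SmoothTriv EG EB EP G π) {p : P} (hp : π p ∈ τ.baseSet) :
    τ.point (π p) (τ.toOpenPartialHomeomorph p).2 = p := by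
  have hs : p ∈ τ.source := by rw [τ.source_eq]; exact hp
  have h : ((π p, (τ.toOpenPartialHomeomorph p).2) : B × G) = τ.toOpenPartialHomeomorph p :=
    Prod.ext (τ.proj_toFun p hs).symm rfl
  rw [point, h, τ.toOpenPartialHomeomorph.left_inv hs]

/-- The transition map from `τ'` to `τ` is of the form `(σ, g) ↦ (σ, L_{β(σ)}(g))` for a smooth
family of bisections `β(σ)`, `σ` in the overlap of the two base sets. Smoothness of the family
means smoothness of `(σ, m) ↦ β(σ)(m)`. -/
def LCompatible (Γ : LieGroupoid EM EG M G) (τ τ' : SmoothTriv EG EB EP G π) : Prop :=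
  ∃ β : B → Γ.Bisection,
    ContMDiffOn (𝓘(ℝ, EB).prod 𝓘(ℝ, EM)) 𝓘(ℝ, EG) ∞ (fun x : B × M => (β x.1).toFun x.2)
      ((τ.baseSet ∩ τ'.baseSet) ×ˢ Set.univ) ∧
    ∀ σ ∈ τ.baseSet ∩ τ'.baseSet, ∀ g : G,
      τ.toOpenPartialHomeomorph (τ'.point σ g) = (σ, Γ.leftMul (β σ) g)

/-- Smoothness of the family in `LCompatible` is automatic. -/
theorem lCompatible_of_pointwise (Γ : LieGroupoid EM EG M G) (τ τ' : SmoothTriv EG EB EP G π)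
    (h : ∀ σ ∈ τ.baseSet ∩ τ'.baseSet, ∃ β : Γ.Bisection, ∀ g : G,
      τ.toOpenPartialHomeomorph (τ'.point σ g) = (σ, Γ.leftMul β g)) :
    LCompatible Γ τ τ' := by
  classical
  choose! β hβ using h
  refine ⟨β, ?_, hβ⟩
  have hsm : ContMDiffOn (𝓘(ℝ, EB).prod 𝓘(ℝ, EM)) (𝓘(ℝ, EB).prod 𝓘(ℝ, EG)) ∞
      (fun x : B × M => τ.toOpenPartialHomeomorph (τ'.point x.1 (Γ.unit x.2)))
      ((τ.baseSet ∩ τ'.baseSet) ×ˢ Set.univ) := by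
    have h1 : ContMDiff (𝓘(ℝ, EB).prod 𝓘(ℝ, EM)) (𝓘(ℝ, EB).prod 𝓘(ℝ, EG)) ∞
        (fun x : B × M => (x.1, Γ.unit x.2)) :=
      contMDiff_fst.prodMk (Γ.contMDiff_unit.comp contMDiff_snd)
    have h2 : ContMDiffOn (𝓘(ℝ, EB).prod 𝓘(ℝ, EM)) 𝓘(ℝ, EP) ∞
        (fun x : B × M => τ'.point x.1 (Γ.unit x.2))
        ((τ.baseSet ∩ τ'.baseSet) ×ˢ Set.univ) :=
      τ'.contMDiffOn_symm.comp h1.contMDiffOn fun x hx => by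
        rw [Set.mem_preimage, τ'.target_eq]
        exact ⟨hx.1.2, Set.mem_univ _⟩
    exact τ.contMDiffOn_toFun.comp h2 fun x hx => by
      rw [Set.mem_preimage, τ.source_eq, Set.mem_preimage, τ'.proj_point hx.1.2]
      exact hx.1.1
  refine (contMDiff_snd.comp_contMDiffOn hsm).congr fun x hx => ?_
  have h3 : Γ.leftMul (β x.1) (Γ.unit x.2) = (β x.1).toFun x.2 := by
    change Γ.mul ((β x.1).toFun (Γ.t (Γ.unit x.2))) (Γ.unit x.2) = _
    rw [Γ.t_unit]
    have h4 := Γ.mul_unit ((β x.1).toFun x.2)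
    rwa [(β x.1).s_toFun] at h4
  rw [Function.comp_apply, hβ x.1 hx.1, h3]

theorem lCompatible_refl (Γ : LieGroupoid EM EG M G) (τ : SmoothTriv EG EB EP G π) :
    LCompatible Γ τ τ :=
  lCompatible_of_pointwise Γ τ τ fun σ hσ => ⟨1, fun g => by
    rw [τ.apply_point hσ.1, map_one, diff_one_apply]⟩

theorem lCompatible_symm (Γ : LieGroupoid EM EG M G) {τ τ' : SmoothTriv EG EB EP G π}
    (h : LCompatible Γ τ τ') : LCompatible Γ τ' τ := by
  obtain ⟨β, -, hβ⟩ := h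
  refine lCompatible_of_pointwise Γ τ' τ fun σ hσ => ⟨(β σ)⁻¹, fun g => ?_⟩
  have h1 := hβ σ ⟨hσ.2, hσ.1⟩ (Γ.leftMul (β σ)⁻¹ g)
  rw [← diff_mul_apply, ← map_mul, mul_inv_cancel, map_one, diff_one_apply] at h1
  have h2 : τ'.point σ (Γ.leftMul (β σ)⁻¹ g) = τ.point σ g := by
    have h3 : π (τ'.point σ (Γ.leftMul (β σ)⁻¹ g)) = σ := τ'.proj_point hσ.1 _
    have h4 := τ.point_apply (p := τ'.point σ (Γ.leftMul (β σ)⁻¹ g)) (by rw [h3]; exact hσ.2)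
    rw [h1, h3] at h4
    exact h4.symm
  rw [← h2, τ'.apply_point hσ.1]

end SmoothTriv

/-- An atlas of smooth local trivialisations of `π : P → B` with fibre `G` whose transition maps
are smooth families of left-multiplications by bisections. -/
structure LAtlas (EB EP : Type*)
    [NormedAddCommGroup EB] [NormedSpace ℝ EB] [NormedAddCommGroup EP] [NormedSpace ℝ EP]
    {B P : Type*} [TopologicalSpace B] [ChartedSpace EB B] [TopologicalSpace P] [ChartedSpace EP P]
    (Γ : LieGroupoid EM EG M G) (π : P → B) where
  /-- the trivialisations of the atlas -/
  trivs : Set (SmoothTriv EG EB EP G π)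
  covers : ∀ σ : B, ∃ τ ∈ trivs, σ ∈ τ.baseSet
  compatible : ∀ τ ∈ trivs, ∀ τ' ∈ trivs, SmoothTriv.LCompatible Γ τ τ'

/-- Two atlases are equivalent if all transition maps of their union are smooth families of
left-multiplications by bisections. -/
instance lAtlasSetoid (Γ : LieGroupoid EM EG M G) (π : P → B) : Setoid (LAtlas EB EP Γ π) where
  r 𝒜 𝒜' := ∀ τ ∈ 𝒜.trivs ∪ 𝒜'.trivs, ∀ τ' ∈ 𝒜.trivs ∪ 𝒜'.trivs, SmoothTriv.LCompatible Γ τ τ'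
  iseqv := by
    refine ⟨fun 𝒜 τ hτ τ' hτ' => ?_, fun {𝒜 𝒜'} h τ hτ τ' hτ' => ?_, fun {𝒜 𝒜' 𝒜''} h h' => ?_⟩
    · rw [Set.union_self] at hτ hτ'
      exact 𝒜.compatible τ hτ τ' hτ'
    · rw [Set.union_comm] at hτ hτ'
      exact h τ hτ τ' hτ'
    · have key : ∀ τ ∈ 𝒜.trivs, ∀ τ'' ∈ 𝒜''.trivs, SmoothTriv.LCompatible Γ τ τ'' := by
        intro τ hτ τ'' hτ''
        refine SmoothTriv.lCompatible_of_pointwise Γ τ τ'' fun σ hσ => ?_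
        obtain ⟨τ', hτ', hσ'⟩ := 𝒜'.covers σ
        obtain ⟨β, -, hβ⟩ := h τ (Or.inl hτ) τ' (Or.inr hτ')
        obtain ⟨γ, -, hγ⟩ := h' τ' (Or.inl hτ') τ'' (Or.inr hτ'')
        refine ⟨β σ * γ σ, fun g => ?_⟩
        have h1 := hγ σ ⟨hσ', hσ.2⟩ g
        have h2 := hβ σ ⟨hσ.1, hσ'⟩ (Γ.leftMul (γ σ) g)
        have h3 : π (τ''.point σ g) = σ := τ''.proj_point hσ.2 g
        have h4 := τ'.point_apply (p := τ''.point σ g) (by rw [h3]; exact hσ')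
        rw [h1, h3] at h4
        rw [← h4, h2, map_mul, diff_mul_apply]
      rintro τ (hτ | hτ) τ' (hτ' | hτ')
      · exact 𝒜.compatible τ hτ τ' hτ'
      · exact key τ hτ τ' hτ'
      · exact SmoothTriv.lCompatible_symm Γ (key τ' hτ' τ hτ)
      · exact 𝒜''.compatible τ hτ τ' hτ'

/-- The structures of a principaloid bundle on `π : P → B`: reductions of the structure group to
`L(𝔹)`, that is, equivalence classes of atlases with transition maps in `L(𝔹)`. -/
def PrincipaloidStructure (EB EP : Type*)
    [NormedAddCommGroup EB] [NormedSpace ℝ EB] [NormedAddCommGroup EP] [NormedSpace ℝ EP]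
    {B P : Type*} [TopologicalSpace B] [ChartedSpace EB B] [TopologicalSpace P] [ChartedSpace EP P]
    (Γ : LieGroupoid EM EG M G) (π : P → B) : Type _ :=
  Quotient (lAtlasSetoid (EB := EB) (EP := EP) Γ π)

/-- The structures of a principaloid `G`-bundle on `π : P → B`: right `G`-module structures on `P`
(moment map `μ`, action of `g` on those `p` with `μ p = t g`) which preserve the fibres of `π` and
admit equivariant smooth local trivialisations, where `G` acts on the fibre `G` by right
translations. Where it is not defined, the action is given the value `p`. -/
structure PrincipaloidGStructure (EB EP : Type*)
    [NormedAddCommGroup EB] [NormedSpace ℝ EB] [NormedAddCommGroup EP] [NormedSpace ℝ EP]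
    {B P : Type*} [TopologicalSpace B] [ChartedSpace EB B] [TopologicalSpace P] [ChartedSpace EP P]
    (Γ : LieGroupoid EM EG M G) (π : P → B) where
  /-- the moment map -/
  μ : P → M
  /-- the action `p ◂ g` -/
  act : P → G → P
  act_of_ne : ∀ p g, μ p ≠ Γ.t g → act p g = p
  contMDiff_μ : ContMDiff 𝓘(ℝ, EP) 𝓘(ℝ, EM) ∞ μ
  contMDiffOn_act : ContMDiffOn (𝓘(ℝ, EP).prod 𝓘(ℝ, EG)) 𝓘(ℝ, EP) ∞
    (fun x : P × G => act x.1 x.2) {x | μ x.1 = Γ.t x.2}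
  μ_act : ∀ p g, μ p = Γ.t g → μ (act p g) = Γ.s g
  act_unit : ∀ p, act p (Γ.unit (μ p)) = p
  act_act : ∀ p g h, μ p = Γ.t g → Γ.s g = Γ.t h → act (act p g) h = act p (Γ.mul g h)
  proj_act : ∀ p g, μ p = Γ.t g → π (act p g) = π p
  locally_trivial : ∀ σ : B, ∃ τ : SmoothTriv EG EB EP G π, σ ∈ τ.baseSet ∧
    ∀ σ' ∈ τ.baseSet, ∀ g : G, μ (τ.point σ' g) = Γ.s g ∧
      ∀ h : G, Γ.s g = Γ.t h → act (τ.point σ' g) h = τ.point σ' (Γ.mul g h)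

/-- `τ` is equivariant for the right `G`-module structure. -/
def PrincipaloidGStructure.IsEquivariant {Γ : LieGroupoid EM EG M G} {π : P → B}
    (X : PrincipaloidGStructure EB EP Γ π) (τ : SmoothTriv EG EB EP G π) : Prop :=
  ∀ σ ∈ τ.baseSet, ∀ g : G, X.μ (τ.point σ g) = Γ.s g ∧
    ∀ h : G, Γ.s g = Γ.t h → X.act (τ.point σ g) h = τ.point σ (Γ.mul g h)

/-- The structures of a `G`-fibred `𝔹`-bundle on `π : P → B`: right actions of the group `𝔹` of
bisections on `P` by diffeomorphisms which preserve the fibres of `π` and admit equivariant smooth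
local trivialisations, where `𝔹` acts on the fibre `G` by right-multiplication. -/
structure BisectionBundleStructure (EB EP : Type*)
    [NormedAddCommGroup EB] [NormedSpace ℝ EB] [NormedAddCommGroup EP] [NormedSpace ℝ EP]
    {B P : Type*} [TopologicalSpace B] [ChartedSpace EB B] [TopologicalSpace P] [ChartedSpace EP P]
    (Γ : LieGroupoid EM EG M G) (π : P → B) where
  /-- the right action, as a homomorphism from the opposite group -/
  act : Γ.Bisectionᵐᵒᵖ →* Diffeomorph 𝓘(ℝ, EP) 𝓘(ℝ, EP) P P ∞
  proj_act : ∀ β p, π (act β p) = π p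
  locally_trivial : ∀ σ : B, ∃ τ : SmoothTriv EG EB EP G π, σ ∈ τ.baseSet ∧
    ∀ σ' ∈ τ.baseSet, ∀ (β : Γ.Bisectionᵐᵒᵖ) (g : G),
      act β (τ.point σ' g) = τ.point σ' (Γ.rightMul β g)

/-- `τ` is equivariant for the right `𝔹`-action. -/
def BisectionBundleStructure.IsEquivariant {Γ : LieGroupoid EM EG M G} {π : P → B}
    (Y : BisectionBundleStructure EB EP Γ π) (τ : SmoothTriv EG EB EP G π) : Prop :=
  ∀ σ ∈ τ.baseSet, ∀ (β : Γ.Bisectionᵐᵒᵖ) (g : G),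
    Y.act β (τ.point σ g) = τ.point σ (Γ.rightMul β g)

end Bundles

/-!
The heart of the matter is the centraliser of `R(𝔹)`. Let `φ` be a map of the arrow manifold `G`
commuting with all right-multiplications. By `Id`-reducibility an arrow `g` is obtained from the
unit arrow at `t g` by a right-multiplication, so `φ` is determined by its values on the units; if
these keep their sources, i.e. `s (φ (Id_m)) = m`, then `φ g = φ (Id_{t g}).g`
(`LieGroupoid.eq_mul_of_commute`), and applying this to a diffeomorphism and to its inverse shows
that `m ↦ φ (Id_m)` is a bisection (`LieGroupoid.exists_leftMul_eq_of_commute`).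

That the sources are kept is trivial if `M` has at most one point, and otherwise it is where the
dimensions enter (`LieGroupoid.s_map_unit_of_commute`). A bisection with value `Id_m` at `m` fixes
`Id_m` under `R`, hence fixes `φ (Id_m)`, and therefore it is also the unit at `n = s (φ (Id_m))`.
If `n ≠ m`, a bisection violating this is constructed in
`LieGroupoid.exists_bisection_eq_unit_ne_unit`: as `dim G > dim M`, the fibres of `s` have positive
dimension, and the unit section can be pushed along them near `n` by a bump function. When the bump
is small, the shadow of the new section is a perturbation of the identity with compact support in a
chart and small derivative, hence a diffeomorphism (`exists_cutoff_diffeomorph`,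
`exists_diffeomorph_eq_chartExtend`).

The statements on bundles follow fibrewise. The transition map of two equivariant trivialisations
of a `G`-fibred `𝔹`-bundle commutes with `R(𝔹)` on each fibre and so lies in `L(𝔹)`
(`BisectionBundleStructure.IsEquivariant.lCompatible`). Conversely, elements of `L(𝔹)` preserve
the source map, commute with right translations and with `R(𝔹)`, so that any of these structures on
the model fibre `G` can be transported to `P` along an atlas with transition maps in `L(𝔹)`. Each
of the structures is determined by its equivariant trivialisations, which are the same for
corresponding structures, and this makes the correspondences bijective.
-/

open scoped Topology
open Set

/-! ### Cutting off a family of maps to a diffeomorphism -/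

section Perturbation

variable {E : Type*} [NormedAddCommGroup E] [NormedSpace ℝ E]

/-- The identity plus a map with derivative at most `1 / 2` is `1 / 2`-Lipschitz close to the
identity, hence bijective, and its derivatives `1 + h'` are invertible by the Neumann series. -/
theorem exists_diffeomorph_of_norm_fderiv_le [CompleteSpace E] {h : E → E} (hh : ContDiff ℝ ∞ h)
    (hle : ∀ x, ‖fderiv ℝ h x‖ ≤ 1 / 2) :
    ∃ f : Diffeomorph 𝓘(ℝ, E) 𝓘(ℝ, E) E E ∞, ∀ x, f x = x + h x := by
  have hdiff : Differentiable ℝ h := hh.differentiable (by simp)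
  have hlip : LipschitzWith (1 / 2) h :=
    lipschitzWith_of_nnnorm_fderiv_le hdiff fun x => by
      rw [← NNReal.coe_le_coe]
      simpa using hle x
  have happ : ApproximatesLinearOn (fun x => x + h x)
      ((ContinuousLinearEquiv.refl ℝ E : E ≃L[ℝ] E) : E →L[ℝ] E) univ (1 / 2) := by
    rw [ApproximatesLinearOn.approximatesLinearOn_iff_lipschitzOnWith]
    convert hlip.lipschitzOnWith (s := univ) using 1
    ext x
    simp
  have hc : Subsingleton E ∨
      (1 / 2 : NNReal) < ‖((ContinuousLinearEquiv.refl ℝ E).symm : E →L[ℝ] E)‖₊⁻¹ := by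
    rcases subsingleton_or_nontrivial E with hE | hE
    · exact Or.inl hE
    · right
      have : ‖((ContinuousLinearEquiv.refl ℝ E).symm : E →L[ℝ] E)‖₊ = 1 :=
        ContinuousLinearMap.nnnorm_id
      rw [this, inv_one]
      exact NNReal.half_lt_self one_ne_zero
  let F : E ≃ₜ E := happ.toHomeomorph _ hc
  have hF : ContDiff ℝ ∞ F := contDiff_id.add hh
  have hlt : ∀ x, ‖-fderiv ℝ h x‖ < 1 := fun x => by
    rw [norm_neg]
    exact (hle x).trans_lt (by norm_num)
  have hF' : ∀ x, HasFDerivAt F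
      ((ContinuousLinearEquiv.unitsEquiv ℝ E (Units.oneSub _ (hlt x)) : E ≃L[ℝ] E) : E →L[ℝ] E)
      x := fun x => by
    have hx : ((ContinuousLinearEquiv.unitsEquiv ℝ E (Units.oneSub _ (hlt x)) : E ≃L[ℝ] E) :
        E →L[ℝ] E) = ContinuousLinearMap.id ℝ E + fderiv ℝ h x := by
      ext v
      simp
    rw [hx]
    exact (hasFDerivAt_id x).add (hdiff x).hasFDerivAt
  exact ⟨⟨F.toEquiv, hF.contMDiff, (F.contDiff_symm hF' hF).contMDiff⟩, fun x => rfl⟩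

/-- If a smooth family of maps with supports in a fixed compact set vanishes at the parameter `0`,
then its derivatives are uniformly small for parameters near `0`. -/
theorem eventually_norm_fderiv_le {U : Set ℝ} (hU : IsOpen U) (hU0 : (0 : ℝ) ∈ U)
    {H : ℝ × E → E} (hH : ContDiffOn ℝ ∞ H (U ×ˢ univ)) {K : Set E} (hK : IsCompact K)
    (hsupp : ∀ ε, ∀ x ∉ K, H (ε, x) = 0) (h0 : ∀ x, H (0, x) = 0) :
    ∀ᶠ ε in 𝓝 (0 : ℝ), ∀ x, ‖fderiv ℝ (fun y => H (ε, y)) x‖ ≤ 1 / 2 := by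
  have hopen : IsOpen (U ×ˢ (univ : Set E)) := hU.prod isOpen_univ
  have hfd : ∀ ε ∈ U, ∀ x, fderiv ℝ (fun y => H (ε, y)) x
      = (fderiv ℝ H (ε, x)).comp (ContinuousLinearMap.inr ℝ ℝ E) := fun ε hε x => by
    have h1 : DifferentiableAt ℝ H (ε, x) :=
      (hH.contDiffAt (hopen.mem_nhds ⟨hε, mem_univ _⟩)).differentiableAt (by simp)
    exact (h1.hasFDerivAt.comp x (hasFDerivAt_prodMk_right ε x)).fderiv
  have hcont : ContinuousOn
      (fun z => ‖(fderiv ℝ H z).comp (ContinuousLinearMap.inr ℝ ℝ E)‖) (U ×ˢ univ) :=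
    ((hH.continuousOn_fderiv_of_isOpen hopen (by simp)).clm_comp continuousOn_const).norm
  have hev : ∀ᶠ ε in 𝓝 (0 : ℝ), ∀ x ∈ K,
      ‖(fderiv ℝ H (ε, x)).comp (ContinuousLinearMap.inr ℝ ℝ E)‖ < 1 / 2 := by
    refine hK.eventually_forall_of_forall_eventually
      (P := fun ε x => ‖(fderiv ℝ H (ε, x)).comp (ContinuousLinearMap.inr ℝ ℝ E)‖ < 1 / 2)
      fun x _ => ?_
    refine (hcont.continuousAt (hopen.mem_nhds ⟨hU0, mem_univ x⟩)).eventually_lt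
      continuousAt_const ?_
    rw [← hfd 0 hU0 x]
    simp [h0]
  filter_upwards [hev, hU.mem_nhds hU0] with ε hε hεU x
  by_cases hx : x ∈ K
  · rw [hfd ε hεU]
    exact (hε x hx).le
  · have : (fun y => H (ε, y)) =ᶠ[𝓝 x] fun _ => 0 := by
      filter_upwards [hK.isClosed.isOpen_compl.mem_nhds hx] with y hy using hsupp ε y hy
    rw [this.fderiv_eq]
    simp

/-- A smooth family of maps `k (ε, ·)` defined near a point `x₀`, with `k (0, ·)` the identity, can
be cut off to a diffeomorphism of the whole space: there is a bump function `η`, with values so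
small that `x ↦ k (η x, x)` is a diffeomorphism. -/
theorem exists_cutoff_diffeomorph [FiniteDimensional ℝ E] {W : Set (ℝ × E)} (hW : IsOpen W)
    {k : ℝ × E → E} (hk : ContDiffOn ℝ ∞ k W) (hk0 : ∀ x, (0, x) ∈ W → k (0, x) = x)
    {x₀ : E} (hx₀ : (0, x₀) ∈ W) :
    ∃ (η : E → ℝ) (f : Diffeomorph 𝓘(ℝ, E) 𝓘(ℝ, E) E E ∞), ContDiff ℝ ∞ η ∧
      HasCompactSupport η ∧ η x₀ ≠ 0 ∧ (∀ x ∈ tsupport η, (0, x) ∈ W) ∧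
      (∀ x, (0, x) ∈ W → (η x, x) ∈ W) ∧ (∀ x, (0, x) ∈ W → f x = k (η x, x)) ∧
      ∀ x ∉ tsupport η, f x = x := by
  -- A box around `(0, x₀)` inside `W`.
  obtain ⟨U, hU, S, hS, hUS⟩ := mem_nhds_prod_iff.1 (hW.mem_nhds hx₀)
  obtain ⟨δ, hδ, hδU⟩ := Metric.mem_nhds_iff.1 hU
  obtain ⟨r, hr, hrS⟩ := Metric.mem_nhds_iff.1 hS
  have hbox : ∀ ε x, |ε| < δ → x ∈ Metric.ball x₀ r → (ε, x) ∈ W := fun ε x hε hx =>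
    hUS ⟨hδU (by simpa using hε), hrS hx⟩
  let χ : ContDiffBump x₀ := ⟨r / 4, r / 2, by linarith, by linarith⟩
  have hχsupp : tsupport χ = Metric.closedBall x₀ (r / 2) := χ.tsupport_eq
  have hχball : tsupport χ ⊆ Metric.ball x₀ r := by
    rw [hχsupp]
    exact Metric.closedBall_subset_ball (by linarith)
  have hsmall : ∀ ε x, |ε| < δ → |ε * χ x| < δ := fun ε x hε => by
    rw [abs_mul, abs_of_nonneg χ.nonneg]
    exact (mul_le_of_le_one_right (abs_nonneg _) χ.le_one).trans_lt hε
  classical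
  -- The displacement of the family cut off by `ε χ`. Where `χ` vanishes it is zero, since
  -- `k (0, ·)` is the identity, so the extension by zero from the ball is smooth.
  let H : ℝ × E → E := fun z =>
    if z.2 ∈ Metric.ball x₀ r then k (z.1 * χ z.2, z.2) - z.2 else 0
  have hHsupp : ∀ ε, ∀ x ∉ tsupport χ, H (ε, x) = 0 := fun ε x hx => by
    by_cases hxb : x ∈ Metric.ball x₀ r
    · have : χ x = 0 := image_eq_zero_of_notMem_tsupport hx
      simp only [H, if_pos hxb, this, mul_zero]
      rw [hk0 x (hbox 0 x (by simpa using hδ) hxb), sub_self]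
    · exact if_neg hxb
  have hH0 : ∀ x, H (0, x) = 0 := fun x => by
    by_cases hxb : x ∈ Metric.ball x₀ r
    · simp only [H, if_pos hxb, zero_mul]
      rw [hk0 x (hbox 0 x (by simpa using hδ) hxb), sub_self]
    · exact if_neg hxb
  have hHsm : ContDiffOn ℝ ∞ H (Metric.ball (0 : ℝ) δ ×ˢ univ) := by
    rintro ⟨ε, x⟩ ⟨hε, -⟩
    refine ContDiffAt.contDiffWithinAt ?_
    by_cases hxb : x ∈ Metric.ball x₀ r
    · have h1 : ContDiffAt ℝ ∞ (fun z : ℝ × E => k (z.1 * χ z.2, z.2) - z.2) (ε, x) := by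
        refine ContDiffAt.sub ?_ contDiffAt_snd
        refine ContDiffAt.comp (g := k) (f := fun z : ℝ × E => (z.1 * χ z.2, z.2)) (ε, x)
          (hk.contDiffAt (hW.mem_nhds (hbox _ _ (hsmall _ _ (by simpa using hε)) hxb))) ?_
        exact (contDiffAt_fst.mul (χ.contDiff.contDiffAt.comp (ε, x) contDiffAt_snd)).prodMk
          contDiffAt_snd
      refine h1.congr_of_eventuallyEq ?_
      filter_upwards [(Metric.isOpen_ball.preimage continuous_snd).mem_nhds
        (show (ε, x) ∈ Prod.snd ⁻¹' Metric.ball x₀ r from hxb)] with z hz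
      exact if_pos hz
    · refine (contDiffAt_const (c := (0 : E))).congr_of_eventuallyEq ?_
      have hx : (ε, x) ∈ (Prod.snd : ℝ × E → E) ⁻¹' (tsupport χ)ᶜ := fun h => hxb (hχball h)
      filter_upwards [((isClosed_tsupport χ).isOpen_compl.preimage continuous_snd).mem_nhds hx]
        with z hz using hHsupp z.1 z.2 hz
  have hev := eventually_norm_fderiv_le Metric.isOpen_ball (Metric.mem_ball_self hδ) hHsm
    χ.hasCompactSupport hHsupp hH0
  obtain ⟨δ', hδ', hle⟩ := Metric.eventually_nhds_iff.1 hev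
  obtain ⟨ε, hε0, hε⟩ := exists_between (lt_min hδ hδ')
  have hεδ : |ε| < δ := by
    rw [abs_of_pos hε0]
    exact hε.trans_le (min_le_left _ _)
  have hHε : ContDiff ℝ ∞ fun x => H (ε, x) := by
    rw [← contDiffOn_univ]
    exact hHsm.comp (contDiff_const.prodMk contDiff_id).contDiffOn fun x _ =>
      ⟨by simpa using hεδ, mem_univ _⟩
  obtain ⟨f, hf⟩ := exists_diffeomorph_of_norm_fderiv_le hHε (hle (by
    rw [Real.dist_eq, sub_zero, abs_of_pos hε0]
    exact hε.trans_le (min_le_right _ _)))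
  have hts : tsupport (fun x => ε * χ x) = tsupport χ := by
    rw [tsupport, tsupport]
    congr 1
    ext x
    simp [hε0.ne']
  have hχ0 : ∀ x ∉ Metric.ball x₀ r, ε * χ x = 0 := fun x hxb => by
    rw [image_eq_zero_of_notMem_tsupport fun h => hxb (hχball h), mul_zero]
  refine ⟨fun x => ε * χ x, f, contDiff_const.mul χ.contDiff, χ.hasCompactSupport.mul_left, ?_,
    fun x hx => ?_, fun x hx => ?_, fun x hx => ?_, fun x hx => ?_⟩
  · change ε * χ x₀ ≠ 0
    rw [χ.one_of_mem_closedBall (Metric.mem_closedBall_self χ.rIn_pos.le), mul_one]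
    exact hε0.ne'
  · rw [hts] at hx
    exact hbox 0 x (by simpa using hδ) (hχball hx)
  · by_cases hxb : x ∈ Metric.ball x₀ r
    · exact hbox _ _ (hsmall ε x hεδ) hxb
    · simpa only [hχ0 x hxb] using hx
  · by_cases hxb : x ∈ Metric.ball x₀ r
    · rw [hf]
      simp only [H, if_pos hxb, add_sub_cancel]
    · rw [hf, show H (ε, x) = 0 from if_neg hxb, add_zero]
      simp only [hχ0 x hxb, hk0 x hx]
  · rw [hts] at hx
    rw [hf, hHsupp ε x hx, add_zero]

end Perturbation

/-! ### Diffeomorphisms supported in a chart -/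

section ExtendByIdentity

variable {E X : Type*} [NormedAddCommGroup E] [TopologicalSpace X]

open Classical in
/-- The self-map of a manifold that is given by `f` in the chart `ψ` and is the identity outside
the domain of the chart. -/
noncomputable def chartExtend (ψ : OpenPartialHomeomorph X E) (f : E → E) (m : X) : X :=
  if m ∈ ψ.source then ψ.symm (f (ψ m)) else m

theorem chartExtend_of_mem {ψ : OpenPartialHomeomorph X E} {f : E → E} {m : X}
    (hm : m ∈ ψ.source) : chartExtend ψ f m = ψ.symm (f (ψ m)) := if_pos hm

theorem chartExtend_of_notMem {ψ : OpenPartialHomeomorph X E} {f : E → E} {m : X}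
    (hm : m ∉ ψ.source) : chartExtend ψ f m = m := if_neg hm

theorem chartExtend_chartExtend {ψ : OpenPartialHomeomorph X E} {f g : E → E}
    (hf : MapsTo f ψ.target ψ.target) (hgf : ∀ x, g (f x) = x) (m : X) :
    chartExtend ψ g (chartExtend ψ f m) = m := by
  by_cases hm : m ∈ ψ.source
  · have h := hf (ψ.map_source hm)
    rw [chartExtend_of_mem hm, chartExtend_of_mem (ψ.map_target h), ψ.right_inv h, hgf,
      ψ.left_inv hm]
  · rw [chartExtend_of_notMem hm, chartExtend_of_notMem hm]

theorem isClosed_chart_symm_image [T2Space X] {ψ : OpenPartialHomeomorph X E} {K : Set E}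
    (hK : IsCompact K) (hKψ : K ⊆ ψ.target) : IsClosed (ψ.symm '' K) :=
  (hK.image_of_continuousOn (ψ.continuousOn_symm.mono hKψ)).isClosed

variable [NormedSpace ℝ E] [ChartedSpace E X]

theorem contMDiff_chartExtend [T2Space X] {ψ : OpenPartialHomeomorph X E}
    (hψ : ψ ∈ IsManifold.maximalAtlas 𝓘(ℝ, E) ∞ X) {f : E → E} (hf : ContDiff ℝ ∞ f)
    {K : Set E} (hK : IsCompact K) (hKψ : K ⊆ ψ.target) (hfK : ∀ x ∉ K, f x = x)
    (hmaps : MapsTo f ψ.target ψ.target) :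
    ContMDiff 𝓘(ℝ, E) 𝓘(ℝ, E) ∞ (chartExtend ψ f) := by
  intro m
  by_cases hm : m ∈ ψ.source
  · have h1 : ContMDiffOn 𝓘(ℝ, E) 𝓘(ℝ, E) ∞ (fun y => ψ.symm (f (ψ y))) ψ.source :=
      (contMDiffOn_symm_of_mem_maximalAtlas hψ).comp
        (hf.contMDiff.comp_contMDiffOn (contMDiffOn_of_mem_maximalAtlas hψ))
        fun y hy => hmaps (ψ.map_source hy)
    refine (h1.contMDiffAt (ψ.open_source.mem_nhds hm)).congr_of_eventuallyEq ?_
    filter_upwards [ψ.open_source.mem_nhds hm] with y hy using chartExtend_of_mem hy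
  · refine contMDiffAt_id.congr_of_eventuallyEq ?_
    have hm' : m ∈ (ψ.symm '' K)ᶜ := by
      rintro ⟨x, hx, rfl⟩
      exact hm (ψ.map_target (hKψ hx))
    filter_upwards [(isClosed_chart_symm_image hK hKψ).isOpen_compl.mem_nhds hm'] with y hy
    by_cases hys : y ∈ ψ.source
    · have : ψ y ∉ K := fun h => hy ⟨ψ y, h, ψ.left_inv hys⟩
      rw [chartExtend_of_mem hys, hfK _ this, ψ.left_inv hys, id]
    · rw [chartExtend_of_notMem hys, id]

/-- A diffeomorphism of the model space that is the identity outside a compact subset of the target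
of a chart extends by the identity to a diffeomorphism of the manifold. -/
theorem exists_diffeomorph_eq_chartExtend [T2Space X] {ψ : OpenPartialHomeomorph X E}
    (hψ : ψ ∈ IsManifold.maximalAtlas 𝓘(ℝ, E) ∞ X) (f : Diffeomorph 𝓘(ℝ, E) 𝓘(ℝ, E) E E ∞)
    {K : Set E} (hK : IsCompact K) (hKψ : K ⊆ ψ.target) (hfK : ∀ x ∉ K, f x = x) :
    ∃ F : Diffeomorph 𝓘(ℝ, E) 𝓘(ℝ, E) X X ∞, ∀ m, F m = chartExtend ψ f m := by
  have hgK : ∀ x ∉ K, f.symm x = x := fun x hx => by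
    conv_lhs => rw [← hfK x hx, f.symm_apply_apply]
  -- A bijection that is the identity off `K` maps `K` into itself.
  have hfmaps : MapsTo f ψ.target ψ.target := fun x hx => by
    by_cases h : f x ∈ K
    · exact hKψ h
    · have := hgK _ h
      rw [f.symm_apply_apply] at this
      rwa [← this]
  have hgmaps : MapsTo f.symm ψ.target ψ.target := fun x hx => by
    by_cases h : f.symm x ∈ K
    · exact hKψ h
    · have := hfK _ h
      rw [f.apply_symm_apply] at this
      rwa [← this]
  exact ⟨⟨⟨chartExtend ψ f, chartExtend ψ f.symm,
    chartExtend_chartExtend hfmaps f.symm_apply_apply,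
    chartExtend_chartExtend hgmaps f.apply_symm_apply⟩,
    contMDiff_chartExtend hψ f.contDiff hK hKψ hfK hfmaps,
    contMDiff_chartExtend hψ f.symm.contDiff hK hKψ hgK hgmaps⟩, fun m => rfl⟩

end ExtendByIdentity

/-! ### Bisections separating points -/

namespace LieGroupoid

variable {EM EG M G : Type*}
  [NormedAddCommGroup EM] [NormedSpace ℝ EM] [FiniteDimensional ℝ EM]
  [NormedAddCommGroup EG] [NormedSpace ℝ EG]
  [TopologicalSpace M] [ChartedSpace EM M]
  [TopologicalSpace G] [ChartedSpace EG G]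

/-- Near an arrow, the source map is a linear projection in suitable charts; if the arrow manifold
has the larger dimension, the projection kills a nonzero vector `w`, along which arrows can be moved
without changing their source. -/
theorem exists_chart_vector (Γ : LieGroupoid EM EG M G)
    (hdim : Module.finrank ℝ EM < Module.finrank ℝ EG) (g : G) :
    ∃ φ ∈ IsManifold.maximalAtlas 𝓘(ℝ, EG) ∞ G, ∃ ψ ∈ IsManifold.maximalAtlas 𝓘(ℝ, EM) ∞ M,
      ∃ w : EG, w ≠ 0 ∧ g ∈ φ.source ∧ (∀ h ∈ φ.source, Γ.s h ∈ ψ.source) ∧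
        ∀ h ∈ φ.source, ∀ ε : ℝ, φ h + ε • w ∈ φ.target →
          Γ.s (φ.symm (φ h + ε • w)) = Γ.s h := by
  obtain ⟨F, _, _, hF⟩ := Γ.isSubmersion_s
  have hg := hF g
  have hFn : Nontrivial F := by
    by_contra hcon
    rw [not_nontrivial_iff_subsingleton] at hcon
    have h1 : Function.Injective (Prod.fst ∘ hg.equiv : EG → EM) := fun x y hxy =>
      hg.equiv.injective (Prod.ext hxy (Subsingleton.elim _ _))
    exact absurd hdim (not_lt.2 (LinearMap.finrank_le_finrank_of_injective
      (f := (LinearMap.fst ℝ EM F).comp hg.equiv.toLinearEquiv.toLinearMap) h1))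
  obtain ⟨v, hv⟩ := exists_ne (0 : F)
  refine ⟨hg.domChart, hg.domChart_mem_maximalAtlas, hg.codChart, hg.codChart_mem_maximalAtlas,
    hg.equiv.symm (0, v), ?_, hg.mem_domChart_source,
    fun h hh => hg.source_subset_preimage_source hh, fun h hh ε hε => ?_⟩
  · rw [Ne, EmbeddingLike.map_eq_zero_iff]
    exact fun h => hv (congrArg Prod.snd h)
  · have hw : ∀ y ∈ hg.domChart.target,
        hg.codChart (Γ.s (hg.domChart.symm y)) = (hg.equiv y).1 := fun y hy =>
      hg.writtenInCharts (by simpa using hy)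
    refine hg.codChart.injOn (hg.source_subset_preimage_source (hg.domChart.map_target hε))
      (hg.source_subset_preimage_source hh) ?_
    rw [hw _ hε]
    conv_rhs => rw [← hg.domChart.left_inv hh, hw _ (hg.domChart.map_source hh)]
    simp

/-- Different points of the object manifold are separated by bisections if the arrow manifold has
the larger dimension: the unit bisection can be perturbed near `n` along the fibres of the source
map. -/
theorem exists_bisection_eq_unit_ne_unit [T2Space M] (Γ : LieGroupoid EM EG M G)
    (hdim : Module.finrank ℝ EM < Module.finrank ℝ EG) {m n : M} (hmn : m ≠ n) :
    ∃ β : Γ.Bisection, β.toFun m = Γ.unit m ∧ β.toFun n ≠ Γ.unit n := by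
  classical
  obtain ⟨φ, hφ, ψ, hψ, w, hw, hn, hsψ, hs⟩ := Γ.exists_chart_vector hdim (Γ.unit n)
  -- The point `m` is removed from `U` so that the bisection is the unit there.
  let U : Set M := Γ.unit ⁻¹' φ.source ∩ {m}ᶜ
  have hUo : IsOpen U :=
    (φ.open_source.preimage Γ.contMDiff_unit.continuous).inter isOpen_compl_singleton
  have hUψ : U ⊆ ψ.source := fun y hy => by
    simpa only [Γ.s_unit] using hsψ _ hy.1
  have hnU : n ∈ U := ⟨hn, hmn.symm⟩
  -- The perturbed unit section read in charts, where the size `ε` of the perturbation is free.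
  let b : ℝ × EM → EG := fun z => φ (Γ.unit (ψ.symm z.2)) + z.1 • w
  let V : Set EM := ψ.target ∩ ψ.symm ⁻¹' U
  have hVo : IsOpen V := ψ.symm.isOpen_inter_preimage hUo
  have hb : ContMDiffOn 𝓘(ℝ, ℝ × EM) 𝓘(ℝ, EG) ∞ b (univ ×ˢ V) := by
    have h1 : ContMDiffOn 𝓘(ℝ, EM) 𝓘(ℝ, EG) ∞ (fun x => φ (Γ.unit (ψ.symm x))) V :=
      (contMDiffOn_of_mem_maximalAtlas hφ).comp
        (Γ.contMDiff_unit.comp_contMDiffOn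
          ((contMDiffOn_symm_of_mem_maximalAtlas hψ).mono inter_subset_left))
        fun x hx => hx.2.1
    have h2 : ContDiffOn ℝ ∞ (fun z : ℝ × EM => φ (Γ.unit (ψ.symm z.2))) (univ ×ˢ V) :=
      h1.contDiffOn.comp contDiff_snd.contDiffOn fun z hz => hz.2
    exact (h2.add (contDiff_fst.smul contDiff_const).contDiffOn).contMDiffOn
  -- The domain on which the target of the perturbed section can be read in the chart `ψ`.
  let W₁ : Set (ℝ × EM) := (univ ×ˢ V) ∩ b ⁻¹' φ.target
  have hW₁o : IsOpen W₁ :=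
    hb.continuousOn.isOpen_inter_preimage (isOpen_univ.prod hVo) φ.open_target
  have hc : ContMDiffOn 𝓘(ℝ, ℝ × EM) 𝓘(ℝ, EM) ∞ (fun z => Γ.t (φ.symm (b z))) W₁ :=
    Γ.contMDiff_t.comp_contMDiffOn
      ((contMDiffOn_symm_of_mem_maximalAtlas hφ).comp (hb.mono inter_subset_left)
        fun z hz => hz.2)
  let W : Set (ℝ × EM) := W₁ ∩ (fun z => Γ.t (φ.symm (b z))) ⁻¹' ψ.source
  have hWo : IsOpen W := hc.continuousOn.isOpen_inter_preimage hW₁o ψ.open_source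
  let k : ℝ × EM → EM := fun z => ψ (Γ.t (φ.symm (b z)))
  have hk : ContDiffOn ℝ ∞ k W :=
    ((contMDiffOn_of_mem_maximalAtlas hψ).comp (hc.mono inter_subset_left)
      fun z hz => hz.2).contDiffOn
  have hb0 : ∀ x ∈ V, φ.symm (b (0, x)) = Γ.unit (ψ.symm x) := fun x hx => by
    simp only [b, zero_smul, add_zero]
    exact φ.left_inv hx.2.1
  have hVW : ∀ x, (0, x) ∈ W ↔ x ∈ V := fun x => by
    refine ⟨fun h => h.1.1.2, fun hx => ⟨⟨⟨mem_univ _, hx⟩, ?_⟩, ?_⟩⟩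
    · simp only [b, mem_preimage, zero_smul, add_zero]
      exact φ.map_source hx.2.1
    · rw [mem_preimage, hb0 x hx, Γ.t_unit]
      exact ψ.map_target hx.1
  have hk0 : ∀ x, (0, x) ∈ W → k (0, x) = x := fun x hx => by
    have hx' := (hVW x).1 hx
    simp only [k]
    rw [hb0 x hx', Γ.t_unit, ψ.right_inv hx'.1]
  have hUV : ∀ y ∈ U, ψ y ∈ V := fun y hy =>
    ⟨ψ.map_source (hUψ hy), by rwa [mem_preimage, ψ.left_inv (hUψ hy)]⟩
  obtain ⟨η, f, hη, hηc, hηn, hηV, hηW, hfV, hfK⟩ :=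
    exists_cutoff_diffeomorph hWo hk hk0 ((hVW _).2 (hUV n hnU))
  have hKV : tsupport η ⊆ V := fun x hx => (hVW x).1 (hηV x hx)
  obtain ⟨F, hF⟩ := exists_diffeomorph_eq_chartExtend hψ f hηc (fun x hx => (hKV hx).1) hfK
  let c : M → G := fun y => φ.symm (φ (Γ.unit y) + η (ψ y) • w)
  have hcb : ∀ y ∈ U, c y = φ.symm (b (η (ψ y), ψ y)) := fun y hy => by
    simp only [c, b, ψ.left_inv (hUψ hy)]
  have hcW : ∀ y ∈ U, (η (ψ y), ψ y) ∈ W := fun y hy => hηW _ ((hVW _).2 (hUV y hy))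
  have hct : ∀ y ∈ U, φ (Γ.unit y) + η (ψ y) • w ∈ φ.target := fun y hy => by
    simpa only [b, mem_preimage, ψ.left_inv (hUψ hy)] using (hcW y hy).1.2
  have hcsm : ContMDiffOn 𝓘(ℝ, EM) 𝓘(ℝ, EG) ∞ c U := by
    refine (contMDiffOn_symm_of_mem_maximalAtlas hφ).comp ?_ hct
    have h1 : ContMDiffOn 𝓘(ℝ, EM) 𝓘(ℝ, EG) ∞ (fun y => φ (Γ.unit y)) U :=
      (contMDiffOn_of_mem_maximalAtlas hφ).comp Γ.contMDiff_unit.contMDiffOn fun y hy => hy.1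
    have h2 : ContMDiffOn 𝓘(ℝ, EM) 𝓘(ℝ, ℝ) ∞ (fun y => η (ψ y)) U :=
      hη.contMDiff.comp_contMDiffOn ((contMDiffOn_of_mem_maximalAtlas hψ).mono hUψ)
    exact h1.add (h2.smul contMDiffOn_const)
  have hcunit : ∀ y ∈ U, ψ y ∉ tsupport η → c y = Γ.unit y := fun y hy hyη => by
    simp only [c, image_eq_zero_of_notMem_tsupport hyη, zero_smul, add_zero]
    exact φ.left_inv hy.1
  refine ⟨⟨fun y => if y ∈ U then c y else Γ.unit y, fun y => ?_, fun y => ?_, F, fun y => ?_⟩,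
    if_neg fun h => h.2 rfl, ?_⟩
  · by_cases hy : y ∈ U
    · refine (hcsm.contMDiffAt (hUo.mem_nhds hy)).congr_of_eventuallyEq ?_
      filter_upwards [hUo.mem_nhds hy] with z hz using if_pos hz
    · refine (Γ.contMDiff_unit y).congr_of_eventuallyEq ?_
      -- Outside the compact, hence closed, image of the support the section is the unit.
      have hy' : y ∈ (ψ.symm '' tsupport η)ᶜ := by
        rintro ⟨x, hx, rfl⟩
        exact hy (hKV hx).2
      filter_upwards [(isClosed_chart_symm_image hηc fun x hx =>
        (hKV hx).1).isOpen_compl.mem_nhds hy'] with z hz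
      by_cases hzU : z ∈ U
      · rw [if_pos hzU]
        exact hcunit z hzU fun h => hz ⟨ψ z, h, ψ.left_inv (hUψ hzU)⟩
      · exact if_neg hzU
  · by_cases hy : y ∈ U
    · simp only [if_pos hy]
      exact (hs _ hy.1 _ (hct y hy)).trans (Γ.s_unit y)
    · simp only [if_neg hy, Γ.s_unit]
  · rw [hF]
    by_cases hy : y ∈ U
    · rw [chartExtend_of_mem (hUψ hy), if_pos hy, hfV _ ((hVW _).2 (hUV y hy)), hcb y hy]
      exact ψ.left_inv (hcW y hy).2
    · rw [if_neg hy, Γ.t_unit]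
      by_cases hyψ : y ∈ ψ.source
      · have : ψ y ∉ tsupport η := fun h => hy (by
          have := (hKV h).2
          rwa [mem_preimage, ψ.left_inv hyψ] at this)
        rw [chartExtend_of_mem hyψ, hfK _ this, ψ.left_inv hyψ]
      · exact chartExtend_of_notMem hyψ
  · simp only [if_pos hnU]
    intro h
    have h1 := φ.right_inv (hct n hnU)
    rw [show φ.symm _ = Γ.unit n from h, left_eq_add, smul_eq_zero] at h1
    exact h1.elim hηn hw

end LieGroupoid

/-! ### The centraliser of the right-multiplications -/

namespace LieGroupoid

section Algebra

variable {EM EG M G : Type*}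
  [NormedAddCommGroup EM] [NormedSpace ℝ EM] [NormedAddCommGroup EG] [NormedSpace ℝ EG]
  [TopologicalSpace M] [ChartedSpace EM M] [TopologicalSpace G] [ChartedSpace EG G]
  {Γ : LieGroupoid EM EG M G}

theorem eq_unit_of_mul_eq_left {g h : G} (hgh : Γ.s g = Γ.t h) (hm : Γ.mul g h = g) :
    h = Γ.unit (Γ.s g) := by
  have h1 := Γ.mul_assoc (Γ.inv g) g h (Γ.s_inv g) hgh
  rw [hm, Γ.inv_mul, hgh, Γ.unit_mul, ← hgh] at h1
  exact h1

theorem leftMul_apply (β : Γ.Bisection) (g : G) :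
    Γ.leftMul β g = Γ.mul (β.toFun (Γ.t g)) g := rfl

theorem rightMul_apply (β : Γ.Bisectionᵐᵒᵖ) (g : G) : Γ.rightMul β g = β.unop.rmul g := rfl

theorem s_leftMul (β : Γ.Bisection) (g : G) : Γ.s (Γ.leftMul β g) = Γ.s g :=
  Γ.s_mul _ _ (β.s_toFun _)

theorem leftMul_mul (β : Γ.Bisection) {g h : G} (hgh : Γ.s g = Γ.t h) :
    Γ.leftMul β (Γ.mul g h) = Γ.mul (Γ.leftMul β g) h := by
  rw [leftMul_apply, leftMul_apply, Γ.t_mul _ _ hgh]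
  exact (Γ.mul_assoc _ _ _ (β.s_toFun _) hgh).symm

theorem leftMul_rightMul (β : Γ.Bisection) (γ : Γ.Bisectionᵐᵒᵖ) (g : G) :
    Γ.leftMul β (Γ.rightMul γ g) = Γ.rightMul γ (Γ.leftMul β g) := by
  rw [rightMul_apply, rightMul_apply, Bisection.rmul_eq, Bisection.rmul_eq, s_leftMul]
  exact leftMul_mul β (γ.unop.t_toFun_symm _).symm

/-- A bisection through `h` acts on the arrows composable with `h` as right translation by `h`. -/
theorem Bisection.rmul_eq_mul (β : Γ.Bisection) {g h : G} (hβ : β.toFun (Γ.s h) = h)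
    (hgh : Γ.s g = Γ.t h) : β.rmul g = Γ.mul g h := by
  have h1 : β.shadow.symm (Γ.s g) = Γ.s h := by
    rw [hgh]
    conv_lhs => rw [← hβ, ← β.shadow_apply, β.shadow.symm_apply_apply]
  rw [β.rmul_eq, h1, hβ]

/-- A map commuting with `R(𝔹)` which preserves the source of the unit arrows is left translation
by its values on the unit arrows: right-multiplications act transitively on the arrows with a given
target. -/
theorem eq_mul_of_commute (hΓ : Γ.IsIdReducible) {φ : G → G}
    (hφ : ∀ (β : Γ.Bisection) g, φ (β.rmul g) = β.rmul (φ g))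
    (hs : ∀ m, Γ.s (φ (Γ.unit m)) = m) (g : G) :
    φ g = Γ.mul (φ (Γ.unit (Γ.t g))) g := by
  obtain ⟨β, hβ⟩ := hΓ g
  conv_lhs => rw [← Γ.unit_mul g, ← β.rmul_eq_mul hβ (Γ.s_unit _), hφ,
    β.rmul_eq_mul hβ (hs _)]

end Algebra

variable {EM EG M G : Type*}
  [NormedAddCommGroup EM] [NormedSpace ℝ EM] [FiniteDimensional ℝ EM]
  [NormedAddCommGroup EG] [NormedSpace ℝ EG]
  [TopologicalSpace M] [ChartedSpace EM M] [T2Space M]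
  [TopologicalSpace G] [ChartedSpace EG G] {Γ : LieGroupoid EM EG M G}

/-- A map commuting with `R(𝔹)` preserves the source of every unit arrow: the stabiliser of `Id_m`
under `R`, the bisections with value `Id_m` at `m`, has to fix the image of `Id_m`, hence consists
of bisections which are the unit at the source of that image. -/
theorem s_map_unit_of_commute
    (hdim : Subsingleton M ∨ Module.finrank ℝ EM < Module.finrank ℝ EG) {φ : G → G}
    (hφ : ∀ (β : Γ.Bisection) g, φ (β.rmul g) = β.rmul (φ g)) (m : M) :
    Γ.s (φ (Γ.unit m)) = m := by
  rcases hdim with _ | hdim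
  · exact Subsingleton.elim _ _
  by_contra hne
  obtain ⟨β, hβm, hβn⟩ := Γ.exists_bisection_eq_unit_ne_unit hdim (Ne.symm hne)
  have h1 : β.rmul (Γ.unit m) = Γ.unit m := by
    rw [β.rmul_eq_mul (h := Γ.unit m) (by rw [Γ.s_unit, hβm]) (by rw [Γ.s_unit, Γ.t_unit])]
    simpa only [Γ.t_unit] using Γ.unit_mul (Γ.unit m)
  have h2 : β.rmul (φ (Γ.unit m)) = φ (Γ.unit m) := by rw [← hφ, h1]
  have h3 := β.s_rmul (φ (Γ.unit m))
  rw [h2] at h3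
  rw [β.rmul_eq, ← h3] at h2
  refine hβn (eq_unit_of_mul_eq_left ?_ h2)
  rw [← β.shadow_apply]
  conv_rhs => rw [h3, β.shadow.apply_symm_apply]

/-- A diffeomorphism commuting with `R(𝔹)` is `L_β` for the bisection `β(m) = φ(Id_m)`, whose shadow
is inverted by the map obtained in the same way from `φ⁻¹`. -/
theorem exists_leftMul_eq_of_commute (hΓ : Γ.IsIdReducible)
    (hdim : Subsingleton M ∨ Module.finrank ℝ EM < Module.finrank ℝ EG)
    (φ : Diffeomorph 𝓘(ℝ, EG) 𝓘(ℝ, EG) G G ∞)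
    (hφ : ∀ (β : Γ.Bisectionᵐᵒᵖ) g, φ (Γ.rightMul β g) = Γ.rightMul β (φ g)) :
    ∃ β : Γ.Bisection, Γ.leftMul β = φ := by
  have hφ₁ : ∀ (β : Γ.Bisection) g, φ (β.rmul g) = β.rmul (φ g) := fun β g => hφ (.op β) g
  have hφ₂ : ∀ (β : Γ.Bisection) g, φ.symm (β.rmul g) = β.rmul (φ.symm g) := fun β g => by
    refine φ.injective ?_
    change φ (φ.symm (β.rmul g)) = φ (β.rmul (φ.symm g))
    rw [hφ₁, φ.apply_symm_apply, φ.apply_symm_apply]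
  have hs₁ := s_map_unit_of_commute hdim hφ₁
  have hs₂ := s_map_unit_of_commute hdim hφ₂
  have hm₁ := eq_mul_of_commute hΓ hφ₁ hs₁
  have hm₂ := eq_mul_of_commute hΓ hφ₂ hs₂
  have ht₁ : ∀ g, Γ.t (φ g) = Γ.t (φ (Γ.unit (Γ.t g))) := fun g => by
    conv_lhs => rw [hm₁, Γ.t_mul _ _ (hs₁ _)]
  have ht₂ : ∀ g, Γ.t (φ.symm g) = Γ.t (φ.symm (Γ.unit (Γ.t g))) := fun g => by
    conv_lhs => rw [hm₂, Γ.t_mul _ _ (hs₂ _)]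
  let F : Diffeomorph 𝓘(ℝ, EM) 𝓘(ℝ, EM) M M ∞ :=
    ⟨⟨fun m => Γ.t (φ (Γ.unit m)), fun m => Γ.t (φ.symm (Γ.unit m)),
      fun m => by
        change Γ.t (φ.symm (Γ.unit (Γ.t (φ (Γ.unit m))))) = m
        rw [← ht₂, φ.symm_apply_apply, Γ.t_unit],
      fun m => by
        change Γ.t (φ (Γ.unit (Γ.t (φ.symm (Γ.unit m))))) = m
        rw [← ht₁, φ.apply_symm_apply, Γ.t_unit]⟩,
      Γ.contMDiff_t.comp (φ.contMDiff.comp Γ.contMDiff_unit),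
      Γ.contMDiff_t.comp (φ.symm.contMDiff.comp Γ.contMDiff_unit)⟩
  exact ⟨⟨fun m => φ (Γ.unit m), φ.contMDiff.comp Γ.contMDiff_unit, hs₁, F, fun m => rfl⟩,
    Diffeomorph.ext fun g => (hm₁ g).symm⟩

theorem centralizer_range_rightMul (hΓ : Γ.IsIdReducible)
    (hdim : Subsingleton M ∨ Module.finrank ℝ EM < Module.finrank ℝ EG) :
    Subgroup.centralizer (Γ.rightMul.range : Set (Diffeomorph 𝓘(ℝ, EG) 𝓘(ℝ, EG) G G ∞))
      = Γ.leftMul.range := by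
  ext φ
  rw [Subgroup.mem_centralizer_iff, MonoidHom.mem_range]
  constructor
  · intro h
    exact exists_leftMul_eq_of_commute hΓ hdim φ fun β g =>
      (DFunLike.congr_fun (h (Γ.rightMul β) ⟨β, rfl⟩) g).symm
  · rintro ⟨β, rfl⟩ _ ⟨γ, rfl⟩
    exact Diffeomorph.ext fun g => (leftMul_rightMul β γ g).symm

end LieGroupoid

/-! ### Fibre coordinates and transition maps -/

section Bundles

variable {EM EG EB EP M G B P : Type*}
  [NormedAddCommGroup EM] [NormedSpace ℝ EM] [NormedAddCommGroup EG] [NormedSpace ℝ EG]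
  [NormedAddCommGroup EB] [NormedSpace ℝ EB] [NormedAddCommGroup EP] [NormedSpace ℝ EP]
  [TopologicalSpace M] [ChartedSpace EM M] [TopologicalSpace G] [ChartedSpace EG G]
  [TopologicalSpace B] [ChartedSpace EB B] [TopologicalSpace P] [ChartedSpace EP P]
  {Γ : LieGroupoid EM EG M G} {π : P → B}

namespace SmoothTriv

/-- The fibre coordinate of a point of `P`, meaningful over `baseSet`. -/
def coord (τ : SmoothTriv EG EB EP G π) (p : P) : G := (τ.toOpenPartialHomeomorph p).2

theorem point_coord (τ : SmoothTriv EG EB EP G π) {p : P} (hp : π p ∈ τ.baseSet) :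
    τ.point (π p) (τ.coord p) = p := τ.point_apply hp

theorem coord_point (τ : SmoothTriv EG EB EP G π) {σ : B} (hσ : σ ∈ τ.baseSet) (g : G) :
    τ.coord (τ.point σ g) = g := by rw [coord, τ.apply_point hσ]

theorem point_coord_of_proj_eq (τ : SmoothTriv EG EB EP G π) {σ : B} (hσ : σ ∈ τ.baseSet) {p : P}
    (hp : π p = σ) : τ.point σ (τ.coord p) = p := by
  subst hp
  exact τ.point_coord hσ

theorem exists_eq_point (τ : SmoothTriv EG EB EP G π) {p : P} (hp : π p ∈ τ.baseSet) :
    ∃ σ ∈ τ.baseSet, ∃ g, p = τ.point σ g :=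
  ⟨π p, hp, τ.coord p, (τ.point_coord hp).symm⟩

theorem source_mem_nhds (τ : SmoothTriv EG EB EP G π) {p : P} (hp : π p ∈ τ.baseSet) :
    τ.source ∈ 𝓝 p :=
  τ.open_source.mem_nhds (by rw [τ.source_eq]; exact hp)

theorem contMDiffOn_coord (τ : SmoothTriv EG EB EP G π) :
    ContMDiffOn 𝓘(ℝ, EP) 𝓘(ℝ, EG) ∞ τ.coord τ.source :=
  contMDiff_snd.comp_contMDiffOn τ.contMDiffOn_toFun

theorem contMDiffOn_proj (τ : SmoothTriv EG EB EP G π) :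
    ContMDiffOn 𝓘(ℝ, EP) 𝓘(ℝ, EB) ∞ π τ.source :=
  (contMDiff_fst.comp_contMDiffOn τ.contMDiffOn_toFun).congr fun p hp =>
    (τ.proj_toFun p hp).symm

/-- Maps into `P` are smooth if their base components and fibre coordinates are. -/
theorem contMDiffWithinAt_point {E' H' X : Type*} [NormedAddCommGroup E'] [NormedSpace ℝ E']
    [TopologicalSpace H'] {I : ModelWithCorners ℝ E' H'} [TopologicalSpace X] [ChartedSpace H' X]
    (τ : SmoothTriv EG EB EP G π) {f : X → B} {h : X → G} {S : Set X} {x : X}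
    (hf : ContMDiffWithinAt I 𝓘(ℝ, EB) ∞ f S x) (hh : ContMDiffWithinAt I 𝓘(ℝ, EG) ∞ h S x)
    (hx : f x ∈ τ.baseSet) :
    ContMDiffWithinAt I 𝓘(ℝ, EP) ∞ (fun y => τ.point (f y) (h y)) S x := by
  have hmem : (f x, h x) ∈ τ.target := by
    rw [τ.target_eq]
    exact ⟨hx, mem_univ _⟩
  exact (τ.contMDiffOn_symm.contMDiffAt (τ.open_target.mem_nhds hmem)).comp_contMDiffWithinAt x
    (hf.prodMk hh)

theorem contMDiff_point (τ : SmoothTriv EG EB EP G π) {σ : B} (hσ : σ ∈ τ.baseSet) :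
    ContMDiff 𝓘(ℝ, EG) 𝓘(ℝ, EP) ∞ (τ.point σ) := fun g =>
  (τ.contMDiffWithinAt_point (contMDiffWithinAt_const (c := σ)) contMDiffWithinAt_id hσ
    : ContMDiffWithinAt _ _ _ _ univ g)

/-- The transition map between two trivialisations on the fibre over `σ`, as a diffeomorphism. -/
theorem exists_transition (τ τ' : SmoothTriv EG EB EP G π) {σ : B}
    (hσ : σ ∈ τ.baseSet ∩ τ'.baseSet) :
    ∃ φ : Diffeomorph 𝓘(ℝ, EG) 𝓘(ℝ, EG) G G ∞, ∀ g, τ'.point σ g = τ.point σ (φ g) := by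
  have hsm : ∀ τ τ' : SmoothTriv EG EB EP G π, σ ∈ τ.baseSet → σ ∈ τ'.baseSet →
      ContMDiff 𝓘(ℝ, EG) 𝓘(ℝ, EG) ∞ fun g => τ.coord (τ'.point σ g) := fun τ τ' h h' =>
    contMDiffOn_univ.1 (τ.contMDiffOn_coord.comp (τ'.contMDiff_point h').contMDiffOn
      fun g _ => by
        rw [mem_preimage, τ.source_eq, mem_preimage, τ'.proj_point h']
        exact h)
  have hpt : ∀ τ τ' : SmoothTriv EG EB EP G π, σ ∈ τ.baseSet → σ ∈ τ'.baseSet → ∀ g,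
      τ.point σ (τ.coord (τ'.point σ g)) = τ'.point σ g := fun τ τ' h h' g =>
    τ.point_coord_of_proj_eq h (τ'.proj_point h' g)
  exact ⟨⟨⟨fun g => τ.coord (τ'.point σ g), fun g => τ'.coord (τ.point σ g),
    fun g => by
      change τ'.coord (τ.point σ (τ.coord (τ'.point σ g))) = g
      rw [hpt τ τ' hσ.1 hσ.2, τ'.coord_point hσ.2],
    fun g => by
      change τ.coord (τ'.point σ (τ'.coord (τ.point σ g))) = g
      rw [hpt τ' τ hσ.2 hσ.1, τ.coord_point hσ.1]⟩,
    hsm τ τ' hσ.1 hσ.2, hsm τ' τ hσ.2 hσ.1⟩, fun g => (hpt τ τ' hσ.1 hσ.2 g).symm⟩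

/-- The compatibility of trivialisations on one fibre, as a relation between points of `P`. -/
theorem LCompatible.exists_point_eq {τ τ' : SmoothTriv EG EB EP G π} (h : LCompatible Γ τ τ')
    {σ : B} (hσ : σ ∈ τ.baseSet ∩ τ'.baseSet) :
    ∃ β : Γ.Bisection, ∀ g, τ'.point σ g = τ.point σ (Γ.leftMul β g) := by
  obtain ⟨β, -, hβ⟩ := h
  refine ⟨β σ, fun g => ?_⟩
  have h1 : τ.coord (τ'.point σ g) = Γ.leftMul (β σ) g := congrArg Prod.snd (hβ σ hσ g)
  rw [← h1, τ.point_coord_of_proj_eq hσ.1 (τ'.proj_point hσ.2 g)]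

end SmoothTriv

/-! ### Principaloid bundles and fibred bundles of the bisection group -/

namespace LAtlas

variable (𝒜 : LAtlas EB EP Γ π)

/-- A trivialisation of the atlas over a neighbourhood of `σ`. -/
noncomputable def trivAt (σ : B) : SmoothTriv EG EB EP G π := (𝒜.covers σ).choose

theorem trivAt_mem (σ : B) : 𝒜.trivAt σ ∈ 𝒜.trivs := (𝒜.covers σ).choose_spec.1

theorem mem_baseSet_trivAt (σ : B) : σ ∈ (𝒜.trivAt σ).baseSet := (𝒜.covers σ).choose_spec.2

/-- The action of a bisection on `P` that is right-multiplication in the trivialisations of the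
atlas. -/
noncomputable def rightAct (β : Γ.Bisectionᵐᵒᵖ) (p : P) : P :=
  (𝒜.trivAt (π p)).point (π p) (Γ.rightMul β ((𝒜.trivAt (π p)).coord p))

/-- The action is right-multiplication in every compatible trivialisation, because left- and
right-multiplications commute. -/
theorem rightAct_point {τ : SmoothTriv EG EB EP G π}
    (hτ : ∀ τ' ∈ 𝒜.trivs, SmoothTriv.LCompatible Γ τ' τ) {σ : B} (hσ : σ ∈ τ.baseSet)
    (β : Γ.Bisectionᵐᵒᵖ) (g : G) :
    𝒜.rightAct β (τ.point σ g) = τ.point σ (Γ.rightMul β g) := by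
  have hσ' := 𝒜.mem_baseSet_trivAt σ
  obtain ⟨γ, hγ⟩ := (hτ _ (𝒜.trivAt_mem σ)).exists_point_eq ⟨hσ', hσ⟩
  rw [rightAct, τ.proj_point hσ, hγ, SmoothTriv.coord_point _ hσ', hγ,
    LieGroupoid.leftMul_rightMul]

theorem proj_rightAct (β : Γ.Bisectionᵐᵒᵖ) (p : P) : π (𝒜.rightAct β p) = π p :=
  (𝒜.trivAt (π p)).proj_point (𝒜.mem_baseSet_trivAt _) _

theorem rightAct_trivAt_point {σ σ' : B} (hσ' : σ' ∈ (𝒜.trivAt σ).baseSet)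
    (β : Γ.Bisectionᵐᵒᵖ) (g : G) :
    𝒜.rightAct β ((𝒜.trivAt σ).point σ' g) = (𝒜.trivAt σ).point σ' (Γ.rightMul β g) :=
  𝒜.rightAct_point (fun τ' hτ' => 𝒜.compatible τ' hτ' _ (𝒜.trivAt_mem σ)) hσ' β g

theorem rightAct_mul (β γ : Γ.Bisectionᵐᵒᵖ) (p : P) :
    𝒜.rightAct (β * γ) p = 𝒜.rightAct β (𝒜.rightAct γ p) := by
  have h := 𝒜.mem_baseSet_trivAt (π p)
  rw [← (𝒜.trivAt (π p)).point_coord h, 𝒜.rightAct_trivAt_point h, 𝒜.rightAct_trivAt_point h,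
    𝒜.rightAct_trivAt_point h, map_mul, diff_mul_apply]

theorem rightAct_one (p : P) : 𝒜.rightAct 1 p = p := by
  rw [rightAct, map_one, diff_one_apply,
    (𝒜.trivAt (π p)).point_coord (𝒜.mem_baseSet_trivAt (π p))]

theorem contMDiff_rightAct (β : Γ.Bisectionᵐᵒᵖ) :
    ContMDiff 𝓘(ℝ, EP) 𝓘(ℝ, EP) ∞ (𝒜.rightAct β) := fun p => by
  let τ := 𝒜.trivAt (π p)
  have hp : π p ∈ τ.baseSet := 𝒜.mem_baseSet_trivAt (π p)
  have hs := τ.source_mem_nhds hp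
  have h1 : ContMDiffAt 𝓘(ℝ, EP) 𝓘(ℝ, EP) ∞
      (fun q => τ.point (π q) (Γ.rightMul β (τ.coord q))) p :=
    (τ.contMDiffWithinAt_point (τ.contMDiffOn_proj.contMDiffAt hs)
      ((Γ.rightMul β).contMDiff.contMDiffAt.comp p (τ.contMDiffOn_coord.contMDiffAt hs)) hp
      : ContMDiffWithinAt _ _ _ _ univ p)
  refine h1.congr_of_eventuallyEq ?_
  filter_upwards [hs] with q hq
  rw [τ.source_eq] at hq
  conv_lhs => rw [← τ.point_coord hq]
  exact 𝒜.rightAct_trivAt_point hq β _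

/-- The `G`-fibred `𝔹`-bundle defined by an atlas. -/
noncomputable def toBisectionBundle : BisectionBundleStructure EB EP Γ π where
  act :=
    { toFun := fun β =>
        ⟨⟨𝒜.rightAct β, 𝒜.rightAct β⁻¹,
          fun p => by rw [← rightAct_mul, inv_mul_cancel, rightAct_one],
          fun p => by rw [← rightAct_mul, mul_inv_cancel, rightAct_one]⟩,
        𝒜.contMDiff_rightAct β, 𝒜.contMDiff_rightAct β⁻¹⟩
      map_one' := Diffeomorph.ext 𝒜.rightAct_one
      map_mul' := fun β γ => Diffeomorph.ext (𝒜.rightAct_mul β γ) }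
  proj_act := 𝒜.proj_rightAct
  locally_trivial σ := ⟨𝒜.trivAt σ, 𝒜.mem_baseSet_trivAt σ, fun _ hσ' β g =>
    𝒜.rightAct_trivAt_point hσ' β g⟩

theorem isEquivariant_toBisectionBundle {τ : SmoothTriv EG EB EP G π}
    (hτ : ∀ τ' ∈ 𝒜.trivs, SmoothTriv.LCompatible Γ τ' τ) :
    𝒜.toBisectionBundle.IsEquivariant τ :=
  fun _ hσ β g => 𝒜.rightAct_point hτ hσ β g

end LAtlas

namespace BisectionBundleStructure

theorem ext_act {Y Y' : BisectionBundleStructure EB EP Γ π}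
    (h : ∀ β p, Y.act β p = Y'.act β p) : Y = Y' := by
  have hact : Y.act = Y'.act := MonoidHom.ext fun β => Diffeomorph.ext (h β)
  cases Y
  cases Y'
  obtain rfl := hact
  rfl

/-- The action is determined by the equivariant trivialisations. -/
theorem eq_of_isEquivariant {Y Y' : BisectionBundleStructure EB EP Γ π}
    (h : ∀ σ, ∃ τ : SmoothTriv EG EB EP G π,
      σ ∈ τ.baseSet ∧ Y.IsEquivariant τ ∧ Y'.IsEquivariant τ) : Y = Y' :=
  ext_act fun β p => by
    obtain ⟨τ, hp, hτ, hτ'⟩ := h (π p)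
    rw [← τ.point_coord hp, hτ _ hp, hτ' _ hp]

theorem exists_isEquivariant (Y : BisectionBundleStructure EB EP Γ π) (σ : B) :
    ∃ τ : SmoothTriv EG EB EP G π, σ ∈ τ.baseSet ∧ Y.IsEquivariant τ := Y.locally_trivial σ

variable [FiniteDimensional ℝ EM] [T2Space M]

/-- On each fibre the transition map commutes with right-multiplications, so it lies in `L(𝔹)`. -/
theorem IsEquivariant.lCompatible (hΓ : Γ.IsIdReducible)
    (hdim : Subsingleton M ∨ Module.finrank ℝ EM < Module.finrank ℝ EG)
    {Y : BisectionBundleStructure EB EP Γ π} {τ τ' : SmoothTriv EG EB EP G π}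
    (hτ : Y.IsEquivariant τ) (hτ' : Y.IsEquivariant τ') : SmoothTriv.LCompatible Γ τ τ' := by
  refine SmoothTriv.lCompatible_of_pointwise Γ τ τ' fun σ hσ => ?_
  obtain ⟨φ, hφ⟩ := SmoothTriv.exists_transition τ τ' hσ
  obtain ⟨β, rfl⟩ := LieGroupoid.exists_leftMul_eq_of_commute hΓ hdim φ fun β g => by
    have h1 := hτ' σ hσ.2 β g
    rw [hφ, hφ, hτ σ hσ.1] at h1
    have h2 := congrArg τ.coord h1
    rw [τ.coord_point hσ.1, τ.coord_point hσ.1] at h2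
    exact h2.symm
  exact ⟨β, fun g => by rw [hφ, τ.apply_point hσ.1]⟩

/-- The atlas of all equivariant trivialisations. -/
def equivariantAtlas (hΓ : Γ.IsIdReducible)
    (hdim : Subsingleton M ∨ Module.finrank ℝ EM < Module.finrank ℝ EG)
    (Y : BisectionBundleStructure EB EP Γ π) : LAtlas EB EP Γ π where
  trivs := {τ | Y.IsEquivariant τ}
  covers σ := by
    obtain ⟨τ, hσ, hτ⟩ := Y.exists_isEquivariant σ
    exact ⟨τ, hτ, hσ⟩
  compatible _ hτ _ hτ' := IsEquivariant.lCompatible hΓ hdim hτ hτ'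

end BisectionBundleStructure

theorem LAtlas.toBisectionBundle_eq_iff (𝒜 : LAtlas EB EP Γ π)
    (Y : BisectionBundleStructure EB EP Γ π) :
    𝒜.toBisectionBundle = Y ↔ ∀ τ ∈ 𝒜.trivs, Y.IsEquivariant τ := by
  have hmem : ∀ τ ∈ 𝒜.trivs, 𝒜.toBisectionBundle.IsEquivariant τ := fun τ hτ =>
    𝒜.isEquivariant_toBisectionBundle fun τ' hτ' => 𝒜.compatible τ' hτ' τ hτ
  constructor
  · rintro rfl
    exact hmem
  · intro h
    refine BisectionBundleStructure.eq_of_isEquivariant fun σ => ?_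
    obtain ⟨τ, hτ, hσ⟩ := 𝒜.covers σ
    exact ⟨τ, hσ, hmem τ hτ, h τ hτ⟩

theorem exists_equiv_bisectionBundle [FiniteDimensional ℝ EM] [T2Space M]
    (hΓ : Γ.IsIdReducible)
    (hdim : Subsingleton M ∨ Module.finrank ℝ EM < Module.finrank ℝ EG) (π : P → B) :
    ∃ Φ : PrincipaloidStructure EB EP Γ π ≃ BisectionBundleStructure EB EP Γ π,
      ∀ (𝒜 : LAtlas EB EP Γ π) (Y : BisectionBundleStructure EB EP Γ π),
        Φ (Quotient.mk _ 𝒜) = Y ↔ ∀ τ ∈ 𝒜.trivs, Y.IsEquivariant τ := by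
  have hwd : ∀ 𝒜 𝒜' : LAtlas EB EP Γ π, (lAtlasSetoid Γ π).r 𝒜 𝒜' →
      𝒜.toBisectionBundle = 𝒜'.toBisectionBundle := fun 𝒜 𝒜' h =>
    (𝒜.toBisectionBundle_eq_iff _).2 fun τ hτ =>
      𝒜'.isEquivariant_toBisectionBundle fun τ' hτ' => h τ' (Or.inr hτ') τ (Or.inl hτ)
  let Φ : PrincipaloidStructure EB EP Γ π → BisectionBundleStructure EB EP Γ π :=
    Quotient.lift LAtlas.toBisectionBundle hwd
  have hΦ : Function.Bijective Φ := by
    constructor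
    · refine fun x y => Quotient.inductionOn₂ x y fun 𝒜 𝒜' h => Quotient.sound ?_
      have h1 := (𝒜.toBisectionBundle_eq_iff _).1 h
      have h2 := (𝒜'.toBisectionBundle_eq_iff _).1 rfl
      have h3 : ∀ τ ∈ 𝒜.trivs ∪ 𝒜'.trivs, 𝒜'.toBisectionBundle.IsEquivariant τ :=
        fun τ hτ => hτ.elim (h1 τ) (h2 τ)
      exact fun τ hτ τ' hτ' => (h3 τ hτ).lCompatible hΓ hdim (h3 τ' hτ')
    · exact fun Y => ⟨Quotient.mk _ (Y.equivariantAtlas hΓ hdim),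
        ((Y.equivariantAtlas hΓ hdim).toBisectionBundle_eq_iff Y).2 fun _ hτ => hτ⟩
  exact ⟨Equiv.ofBijective Φ hΦ, fun 𝒜 Y => 𝒜.toBisectionBundle_eq_iff Y⟩

end Bundles

/-! ### Groupoid modules and fibred bundles of the bisection group -/

section Modules

variable {EM EG EB EP M G B P : Type*}
  [NormedAddCommGroup EM] [NormedSpace ℝ EM] [NormedAddCommGroup EG] [NormedSpace ℝ EG]
  [NormedAddCommGroup EB] [NormedSpace ℝ EB] [NormedAddCommGroup EP] [NormedSpace ℝ EP]
  [TopologicalSpace M] [ChartedSpace EM M] [TopologicalSpace G] [ChartedSpace EG G]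
  [TopologicalSpace B] [ChartedSpace EB B] [TopologicalSpace P] [ChartedSpace EP P]
  {Γ : LieGroupoid EM EG M G} {π : P → B}

namespace PrincipaloidGStructure

variable (X : PrincipaloidGStructure EB EP Γ π)

/-- The right action of the bisections on a right module, `p ◁ β = p ◂ β((t_*β)⁻¹(μ(p)))`. -/
noncomputable def bisectionAct (β : Γ.Bisection) (p : P) : P :=
  X.act p (β.toFun (β.shadow.symm (X.μ p)))

theorem μ_bisectionAct (β : Γ.Bisection) (p : P) :
    X.μ (X.bisectionAct β p) = β.shadow.symm (X.μ p) := by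
  rw [bisectionAct, X.μ_act _ _ (β.t_toFun_symm _).symm, β.s_toFun]

theorem proj_bisectionAct (β : Γ.Bisection) (p : P) : π (X.bisectionAct β p) = π p :=
  X.proj_act _ _ (β.t_toFun_symm _).symm

theorem bisectionAct_one (p : P) : X.bisectionAct 1 p = p := X.act_unit p

theorem bisectionAct_mul (β γ : Γ.Bisection) (p : P) :
    X.bisectionAct (β * γ) p = X.bisectionAct γ (X.bisectionAct β p) := by
  conv_rhs => rw [bisectionAct, μ_bisectionAct, bisectionAct,
    X.act_act _ _ _ (β.t_toFun_symm _).symm (by rw [β.s_toFun, γ.t_toFun_symm])]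
  have h : (β * γ).shadow.symm (X.μ p) = γ.shadow.symm (β.shadow.symm (X.μ p)) := rfl
  rw [bisectionAct, h, LieGroupoid.Bisection.mul_toFun, γ.shadow.apply_symm_apply]

theorem contMDiff_bisectionAct (β : Γ.Bisection) :
    ContMDiff 𝓘(ℝ, EP) 𝓘(ℝ, EP) ∞ (X.bisectionAct β) :=
  X.contMDiffOn_act.comp_contMDiff
    (contMDiff_id.prodMk
      (β.contMDiff_toFun.comp (β.shadow.symm.contMDiff.comp X.contMDiff_μ)))
    fun _ => (β.t_toFun_symm _).symm

theorem isEquivariant_bisectionAct {τ : SmoothTriv EG EB EP G π} (hτ : X.IsEquivariant τ)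
    {σ : B} (hσ : σ ∈ τ.baseSet) (β : Γ.Bisectionᵐᵒᵖ) (g : G) :
    X.bisectionAct β.unop (τ.point σ g) = τ.point σ (Γ.rightMul β g) := by
  rw [bisectionAct, (hτ σ hσ g).1, (hτ σ hσ g).2 _ (β.unop.t_toFun_symm _).symm,
    LieGroupoid.rightMul_apply, LieGroupoid.Bisection.rmul_eq]

/-- The `G`-fibred `𝔹`-bundle underlying a principaloid `G`-bundle. -/
noncomputable def toBisectionBundle : BisectionBundleStructure EB EP Γ π where
  act :=
    { toFun := fun β =>
        ⟨⟨X.bisectionAct β.unop, X.bisectionAct β.unop⁻¹,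
          fun p => by rw [← bisectionAct_mul, mul_inv_cancel, bisectionAct_one],
          fun p => by rw [← bisectionAct_mul, inv_mul_cancel, bisectionAct_one]⟩,
        X.contMDiff_bisectionAct β.unop, X.contMDiff_bisectionAct β.unop⁻¹⟩
      map_one' := Diffeomorph.ext X.bisectionAct_one
      map_mul' := fun β γ => Diffeomorph.ext (X.bisectionAct_mul γ.unop β.unop) }
  proj_act β := X.proj_bisectionAct β.unop
  locally_trivial σ := by
    obtain ⟨τ, hσ, hτ⟩ := X.locally_trivial σ
    exact ⟨τ, hσ, fun _ hσ' β g => X.isEquivariant_bisectionAct hτ hσ' β g⟩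

theorem IsEquivariant.toBisectionBundle {X : PrincipaloidGStructure EB EP Γ π}
    {τ : SmoothTriv EG EB EP G π} (hτ : X.IsEquivariant τ) :
    X.toBisectionBundle.IsEquivariant τ :=
  fun _ hσ β g => X.isEquivariant_bisectionAct hτ hσ β g

/-- Left-multiplications respect the module structure of the fibre, so a trivialisation compatible
with equivariant ones is equivariant. -/
theorem isEquivariant_of_lCompatible {τ : SmoothTriv EG EB EP G π}
    (h : ∀ τ' : SmoothTriv EG EB EP G π, X.IsEquivariant τ' → SmoothTriv.LCompatible Γ τ' τ) :
    X.IsEquivariant τ := fun σ hσ g => by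
  obtain ⟨τ', hσ', hτ'⟩ : ∃ τ' : SmoothTriv EG EB EP G π, σ ∈ τ'.baseSet ∧ X.IsEquivariant τ' :=
    X.locally_trivial σ
  obtain ⟨β, hβ⟩ := (h τ' hτ').exists_point_eq ⟨hσ', hσ⟩
  have h1 := hτ' σ hσ' (Γ.leftMul β g)
  rw [LieGroupoid.s_leftMul] at h1
  refine ⟨by rw [hβ, h1.1], fun k hk => ?_⟩
  rw [hβ, h1.2 k hk, hβ, LieGroupoid.leftMul_mul β hk]

theorem ext_μ_act {X X' : PrincipaloidGStructure EB EP Γ π} (hμ : ∀ p, X.μ p = X'.μ p)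
    (hact : ∀ p g, X.μ p = Γ.t g → X.act p g = X'.act p g) : X = X' := by
  have h1 : X.μ = X'.μ := funext hμ
  have h2 : X.act = X'.act := funext fun p => funext fun g => by
    by_cases h : X.μ p = Γ.t g
    · exact hact p g h
    · rw [X.act_of_ne p g h, X'.act_of_ne p g (by rwa [← hμ])]
  cases X
  cases X'
  obtain rfl := h1
  obtain rfl := h2
  rfl

/-- The module structure is determined by the equivariant trivialisations. -/
theorem eq_of_isEquivariant {X X' : PrincipaloidGStructure EB EP Γ π}
    (h : ∀ σ, ∃ τ : SmoothTriv EG EB EP G π,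
      σ ∈ τ.baseSet ∧ X.IsEquivariant τ ∧ X'.IsEquivariant τ) : X = X' := by
  refine ext_μ_act (fun p => ?_) fun p g hg => ?_ <;> obtain ⟨τ, hp, hτ, hτ'⟩ := h (π p)
  · rw [← τ.point_coord hp, (hτ _ hp _).1, (hτ' _ hp _).1]
  · rw [← τ.point_coord hp, (hτ _ hp _).1] at hg
    rw [← τ.point_coord hp, (hτ _ hp _).2 g hg, (hτ' _ hp _).2 g hg]

variable [FiniteDimensional ℝ EM] [T2Space M]

theorem isEquivariant_iff (hΓ : Γ.IsIdReducible)
    (hdim : Subsingleton M ∨ Module.finrank ℝ EM < Module.finrank ℝ EG)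
    (τ : SmoothTriv EG EB EP G π) :
    X.IsEquivariant τ ↔ X.toBisectionBundle.IsEquivariant τ :=
  ⟨fun h => h.toBisectionBundle, fun h => X.isEquivariant_of_lCompatible fun _ hτ' =>
    hτ'.toBisectionBundle.lCompatible hΓ hdim h⟩

end PrincipaloidGStructure

namespace BisectionBundleStructure

variable (Y : BisectionBundleStructure EB EP Γ π)

/-- An equivariant trivialisation over a neighbourhood of `σ`. -/
noncomputable def trivAt (σ : B) : SmoothTriv EG EB EP G π := (Y.exists_isEquivariant σ).choose

theorem mem_baseSet_trivAt (σ : B) : σ ∈ (Y.trivAt σ).baseSet :=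
  (Y.exists_isEquivariant σ).choose_spec.1

theorem isEquivariant_trivAt (σ : B) : Y.IsEquivariant (Y.trivAt σ) :=
  (Y.exists_isEquivariant σ).choose_spec.2

/-- The moment map: the source of the fibre coordinate. -/
noncomputable def moment (p : P) : M := Γ.s ((Y.trivAt (π p)).coord p)

open Classical in
/-- The groupoid action: right translation of the fibre coordinate. As in
`PrincipaloidGStructure`, its value is `p` where it is not defined. -/
noncomputable def moduleAct (p : P) (g : G) : P :=
  if Y.moment p = Γ.t g then
    (Y.trivAt (π p)).point (π p) (Γ.mul ((Y.trivAt (π p)).coord p) g)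
  else p

variable [FiniteDimensional ℝ EM] [T2Space M]

theorem moment_point (hΓ : Γ.IsIdReducible)
    (hdim : Subsingleton M ∨ Module.finrank ℝ EM < Module.finrank ℝ EG)
    {τ : SmoothTriv EG EB EP G π} (hτ : Y.IsEquivariant τ) {σ : B}
    (hσ : σ ∈ τ.baseSet) (g : G) : Y.moment (τ.point σ g) = Γ.s g := by
  have hσ' := Y.mem_baseSet_trivAt σ
  obtain ⟨β, hβ⟩ :=
    ((Y.isEquivariant_trivAt σ).lCompatible hΓ hdim hτ).exists_point_eq ⟨hσ', hσ⟩
  rw [moment, τ.proj_point hσ, hβ, SmoothTriv.coord_point _ hσ', LieGroupoid.s_leftMul]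

theorem moduleAct_point (hΓ : Γ.IsIdReducible)
    (hdim : Subsingleton M ∨ Module.finrank ℝ EM < Module.finrank ℝ EG)
    {τ : SmoothTriv EG EB EP G π} (hτ : Y.IsEquivariant τ) {σ : B}
    (hσ : σ ∈ τ.baseSet) {g h : G} (hgh : Γ.s g = Γ.t h) :
    Y.moduleAct (τ.point σ g) h = τ.point σ (Γ.mul g h) := by
  have hσ' := Y.mem_baseSet_trivAt σ
  obtain ⟨β, hβ⟩ :=
    ((Y.isEquivariant_trivAt σ).lCompatible hΓ hdim hτ).exists_point_eq ⟨hσ', hσ⟩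
  rw [moduleAct, if_pos ((Y.moment_point hΓ hdim hτ hσ g).trans hgh), τ.proj_point hσ, hβ,
    SmoothTriv.coord_point _ hσ', hβ, LieGroupoid.leftMul_mul β hgh]

theorem contMDiff_moment (hΓ : Γ.IsIdReducible)
    (hdim : Subsingleton M ∨ Module.finrank ℝ EM < Module.finrank ℝ EG) :
    ContMDiff 𝓘(ℝ, EP) 𝓘(ℝ, EM) ∞ Y.moment := fun p => by
  have hs := (Y.trivAt (π p)).source_mem_nhds (Y.mem_baseSet_trivAt (π p))
  refine ((Γ.contMDiff_s.comp_contMDiffOn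
    (Y.trivAt (π p)).contMDiffOn_coord).contMDiffAt hs).congr_of_eventuallyEq ?_
  filter_upwards [hs] with q hq
  rw [(Y.trivAt (π p)).source_eq] at hq
  conv_lhs => rw [← (Y.trivAt (π p)).point_coord hq]
  exact Y.moment_point hΓ hdim (Y.isEquivariant_trivAt _) hq _

theorem contMDiffOn_moduleAct (hΓ : Γ.IsIdReducible)
    (hdim : Subsingleton M ∨ Module.finrank ℝ EM < Module.finrank ℝ EG) :
    ContMDiffOn (𝓘(ℝ, EP).prod 𝓘(ℝ, EG)) 𝓘(ℝ, EP) ∞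
      (fun x : P × G => Y.moduleAct x.1 x.2) {x | Y.moment x.1 = Γ.t x.2} := by
  rintro ⟨p, g⟩ hpg
  have hτ := Y.isEquivariant_trivAt (π p)
  have hp := Y.mem_baseSet_trivAt (π p)
  generalize Y.trivAt (π p) = τ at hτ hp
  have hs := τ.source_mem_nhds hp
  have hfst : ContMDiffAt (𝓘(ℝ, EP).prod 𝓘(ℝ, EG)) 𝓘(ℝ, EP) ∞ (Prod.fst : P × G → P) (p, g) :=
    contMDiffAt_fst
  have hnhds : (Prod.fst : P × G → P) ⁻¹' τ.source ∈ 𝓝[{x | Y.moment x.1 = Γ.t x.2}] (p, g) :=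
    nhdsWithin_le_nhds (continuousAt_fst.preimage_mem_nhds hs)
  have hcoord : ∀ q k, q ∈ τ.source → Y.moment q = Γ.t k → Γ.s (τ.coord q) = Γ.t k :=
    fun q k hq hqk => by
      rw [τ.source_eq] at hq
      rwa [← τ.point_coord hq, Y.moment_point hΓ hdim hτ hq] at hqk
  have heq : ∀ q k, q ∈ τ.source → Y.moment q = Γ.t k →
      Y.moduleAct q k = τ.point (π q) (Γ.mul (τ.coord q) k) := fun q k hq hqk => by
    have h1 := hcoord q k hq hqk
    rw [τ.source_eq] at hq
    conv_lhs => rw [← τ.point_coord hq]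
    exact Y.moduleAct_point hΓ hdim hτ hq h1
  have hmul : ContMDiffWithinAt (𝓘(ℝ, EP).prod 𝓘(ℝ, EG)) 𝓘(ℝ, EG) ∞
      (fun x : P × G => Γ.mul (τ.coord x.1) x.2)
      ({x | Y.moment x.1 = Γ.t x.2} ∩ Prod.fst ⁻¹' τ.source) (p, g) := by
    refine ContMDiffWithinAt.comp (g := fun x : G × G => Γ.mul x.1 x.2)
      (f := fun x : P × G => (τ.coord x.1, x.2)) (p, g)
      (Γ.contMDiffOn_mul (τ.coord p, g) (hcoord p g (mem_of_mem_nhds hs) hpg)) ?_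
      fun x hx => hcoord x.1 x.2 hx.2 hx.1
    exact (((τ.contMDiffOn_coord.contMDiffAt hs).comp (p, g) hfst).prodMk
      contMDiffAt_snd).contMDiffWithinAt
  have hmul' := hmul.mono_of_mem_nhdsWithin
    (Filter.inter_mem self_mem_nhdsWithin hnhds)
  refine (τ.contMDiffWithinAt_point
    (((τ.contMDiffOn_proj.contMDiffAt hs).comp (p, g) hfst).contMDiffWithinAt) hmul'
    hp).congr_of_eventuallyEq ?_ (heq p g (mem_of_mem_nhds hs) hpg)
  filter_upwards [hnhds, self_mem_nhdsWithin] with x hx hx' using heq x.1 x.2 hx hx'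

/-- The principaloid `G`-bundle with the given `𝔹`-action: the module structure is read off in the
equivariant trivialisations. -/
noncomputable def toGStructure (hΓ : Γ.IsIdReducible)
    (hdim : Subsingleton M ∨ Module.finrank ℝ EM < Module.finrank ℝ EG) :
    PrincipaloidGStructure EB EP Γ π where
  μ := Y.moment
  act := Y.moduleAct
  act_of_ne p g h := if_neg h
  contMDiff_μ := Y.contMDiff_moment hΓ hdim
  contMDiffOn_act := Y.contMDiffOn_moduleAct hΓ hdim
  μ_act p g hpg := by
    have hτ := Y.isEquivariant_trivAt (π p)
    obtain ⟨σ, hσ, x, hx⟩ := (Y.trivAt (π p)).exists_eq_point (Y.mem_baseSet_trivAt (π p))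
    generalize Y.trivAt (π p) = τ at *
    subst hx
    rw [Y.moment_point hΓ hdim hτ hσ] at hpg
    rw [Y.moduleAct_point hΓ hdim hτ hσ hpg, Y.moment_point hΓ hdim hτ hσ, Γ.s_mul _ _ hpg]
  act_unit p := by
    have hτ := Y.isEquivariant_trivAt (π p)
    obtain ⟨σ, hσ, x, hx⟩ := (Y.trivAt (π p)).exists_eq_point (Y.mem_baseSet_trivAt (π p))
    generalize Y.trivAt (π p) = τ at *
    subst hx
    rw [Y.moment_point hΓ hdim hτ hσ, Y.moduleAct_point hΓ hdim hτ hσ (Γ.t_unit _).symm,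
      Γ.mul_unit]
  act_act p g h hpg hgh := by
    have hτ := Y.isEquivariant_trivAt (π p)
    obtain ⟨σ, hσ, x, hx⟩ := (Y.trivAt (π p)).exists_eq_point (Y.mem_baseSet_trivAt (π p))
    generalize Y.trivAt (π p) = τ at *
    subst hx
    rw [Y.moment_point hΓ hdim hτ hσ] at hpg
    rw [Y.moduleAct_point hΓ hdim hτ hσ hpg,
      Y.moduleAct_point hΓ hdim hτ hσ ((Γ.s_mul _ _ hpg).trans hgh),
      Y.moduleAct_point hΓ hdim hτ hσ (hpg.trans (Γ.t_mul _ _ hgh).symm),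
      Γ.mul_assoc _ _ _ hpg hgh]
  proj_act p g hpg := by
    have hτ := Y.isEquivariant_trivAt (π p)
    obtain ⟨σ, hσ, x, hx⟩ := (Y.trivAt (π p)).exists_eq_point (Y.mem_baseSet_trivAt (π p))
    generalize Y.trivAt (π p) = τ at *
    subst hx
    rw [Y.moment_point hΓ hdim hτ hσ] at hpg
    rw [Y.moduleAct_point hΓ hdim hτ hσ hpg, τ.proj_point hσ, τ.proj_point hσ]
  locally_trivial σ := ⟨Y.trivAt σ, Y.mem_baseSet_trivAt σ, fun _ hσ' g =>
    ⟨Y.moment_point hΓ hdim (Y.isEquivariant_trivAt σ) hσ' g, fun _ hgh =>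
      Y.moduleAct_point hΓ hdim (Y.isEquivariant_trivAt σ) hσ' hgh⟩⟩

theorem IsEquivariant.toGStructure (hΓ : Γ.IsIdReducible)
    (hdim : Subsingleton M ∨ Module.finrank ℝ EM < Module.finrank ℝ EG)
    {Y : BisectionBundleStructure EB EP Γ π}
    {τ : SmoothTriv EG EB EP G π} (hτ : Y.IsEquivariant τ) :
    (Y.toGStructure hΓ hdim).IsEquivariant τ := fun _ hσ g =>
  ⟨Y.moment_point hΓ hdim hτ hσ g, fun _ hgh => Y.moduleAct_point hΓ hdim hτ hσ hgh⟩

end BisectionBundleStructure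

/-- Principaloid `G`-bundles and `G`-fibred `𝔹`-bundles correspond to each other: both structures
are determined by, and can be transported along, their common equivariant trivialisations. -/
noncomputable def gStructureEquiv [FiniteDimensional ℝ EM] [T2Space M] (hΓ : Γ.IsIdReducible)
    (hdim : Subsingleton M ∨ Module.finrank ℝ EM < Module.finrank ℝ EG) (π : P → B) :
    PrincipaloidGStructure EB EP Γ π ≃ BisectionBundleStructure EB EP Γ π where
  toFun := PrincipaloidGStructure.toBisectionBundle
  invFun Y := Y.toGStructure hΓ hdim
  left_inv X := PrincipaloidGStructure.eq_of_isEquivariant fun σ => by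
    obtain ⟨τ, hσ, hτ⟩ : ∃ τ : SmoothTriv EG EB EP G π, σ ∈ τ.baseSet ∧ X.IsEquivariant τ :=
      X.locally_trivial σ
    exact ⟨τ, hσ, hτ.toBisectionBundle.toGStructure hΓ hdim, hτ⟩
  right_inv Y := BisectionBundleStructure.eq_of_isEquivariant fun σ => by
    obtain ⟨τ, hσ, hτ⟩ := Y.exists_isEquivariant σ
    exact ⟨τ, hσ, (hτ.toGStructure hΓ hdim).toBisectionBundle, hτ⟩

end Modules

theorem mainTheorem3
    {EM EG M G : Type*}
    [NormedAddCommGroup EM] [NormedSpace ℝ EM] [FiniteDimensional ℝ EM]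
    [NormedAddCommGroup EG] [NormedSpace ℝ EG] [FiniteDimensional ℝ EG]
    [TopologicalSpace M] [ChartedSpace EM M] [IsManifold 𝓘(ℝ, EM) ∞ M] [T2Space M]
    [TopologicalSpace G] [ChartedSpace EG G] [IsManifold 𝓘(ℝ, EG) ∞ G]
    (Γ : LieGroupoid EM EG M G) (hΓ : Γ.IsIdReducible)
    (hdim : Subsingleton M ∨ Module.finrank ℝ EM < Module.finrank ℝ EG)
    {EB EP B P : Type*}
    [NormedAddCommGroup EB] [NormedSpace ℝ EB] [FiniteDimensional ℝ EB]
    [NormedAddCommGroup EP] [NormedSpace ℝ EP] [FiniteDimensional ℝ EP]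
    [TopologicalSpace B] [ChartedSpace EB B] [IsManifold 𝓘(ℝ, EB) ∞ B]
    [TopologicalSpace P] [ChartedSpace EP P] [IsManifold 𝓘(ℝ, EP) ∞ P]
    (π : P → B) :
    -- the centraliser of `R(𝔹)` in `Diff(G)` is `L(𝔹)`
    Subgroup.centralizer (Γ.rightMul.range : Set (Diffeomorph 𝓘(ℝ, EG) 𝓘(ℝ, EG) G G ∞))
      = Γ.leftMul.range ∧
    -- principaloid bundles correspond one-to-one to `G`-fibred `𝔹`-bundles, the reduction and the
    -- action being related by equivariance of the trivialisations in the atlas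
    (∃ Φ : PrincipaloidStructure EB EP Γ π ≃ BisectionBundleStructure EB EP Γ π,
      ∀ (𝒜 : LAtlas EB EP Γ π) (Y : BisectionBundleStructure EB EP Γ π),
        Φ (Quotient.mk _ 𝒜) = Y ↔ ∀ τ ∈ 𝒜.trivs, Y.IsEquivariant τ) ∧
    -- any two equivariant trivialisations of a `G`-fibred `𝔹`-bundle have transition maps in `L(𝔹)`
    (∀ (Y : BisectionBundleStructure EB EP Γ π) (τ τ' : SmoothTriv EG EB EP G π),
      Y.IsEquivariant τ → Y.IsEquivariant τ' → SmoothTriv.LCompatible Γ τ τ') ∧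
    -- principaloid `G`-bundles correspond one-to-one to `G`-fibred `𝔹`-bundles, `𝔹` acting through
    -- the `G`-action, with the same equivariant trivialisations
    (∃ Ψ : PrincipaloidGStructure EB EP Γ π ≃ BisectionBundleStructure EB EP Γ π,
      ∀ X : PrincipaloidGStructure EB EP Γ π,
        (∀ (β : Γ.Bisection) (p : P), (Ψ X).act (MulOpposite.op β) p
          = X.act p (β.toFun (β.shadow.symm (X.μ p)))) ∧
        ∀ τ : SmoothTriv EG EB EP G π, X.IsEquivariant τ ↔ (Ψ X).IsEquivariant τ) := by
  exact ⟨LieGroupoid.centralizer_range_rightMul hΓ hdim, exists_equiv_bisectionBundle hΓ hdim π,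
    fun _ _ _ hτ hτ' => hτ.lCompatible hΓ hdim hτ',
    gStructureEquiv hΓ hdim π, fun X => ⟨fun _ _ => rfl, X.isEquivariant_iff hΓ hdim⟩⟩
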